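/- Fix a finite field $\mathbb{F}_q$ and a constant $c_0>0$. A linear circuit over $\mathbb{F}_q$ is a finite directed acyclic graph of gates of unbounded fan-in, each computing a fixed $\mathbb{F}_q$-linear combination of the values on its input wires; its outputs are distinct gates, its size is the number of wires, and its depth is the length of a longest path from an input to an output. A depth-$d$ circuit is one of depth at most $d$. For real $r\le s$, an $(n,r,s)$-partial good code is a linear map $C:\mathbb{F}_q^n\to\mathbb{F}_q^{32n}$ such that $\mathrm{wt}(C(x))\ge 4n$ for every nonzero $x\in\mathbb{F}_q^n$ with $r\le \mathrm{wt}(x)\le s$, where $\mathrm{wt}$ is the Hamming weight. Let $A(0,j)=2j$ for $j\ge1$, $A(i,1)=2$ for $i\ge1$, and $A(i,j)=A(i-1,A(i,j-1))$ for $i\ge1$, $j\ge2$. Let $\lambda_1(n)=\lfloor\sqrt n\rfloor$, $\lambda_2(n)=\lceil\log_2 n\rceil$ and $\lambda_d(n)=\lambda_{d-2}^*(n)$ for $d\ge3$, where $f^*(n)=\min\{i\ge0: f^{(i)}(n)\le1\}$ and $f^{(i)}$ is the $i$-fold iterate of $f$. Then there exist a real constant $c>0$ and an integer constant $D>0$,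 depending only on $q$ and $c_0$, such that the following hold for all integers $n,r,k$. 1. If $c_0\le r\le n$ and $k\ge3$, then some $\bigl(n,\tfrac{n}{A(k-1,r)},\tfrac{n}{r}\bigr)$-partial good code is computed by a depth-$2k$ linear circuit of size at most $2cn$ all of whose output gates have fan-in at most $D$. 2. If $2\le r\le n$ and $k\ge2$, then some $\bigl(n,\tfrac{n}{r},n\bigr)$-partial good code is computed by a depth-$2k$ linear circuit of size at most $3c\,\lambda_{2k}(r)\,n$ (with no bound on the fan-in of the output gates). -/

import Mathlib

/-- A circuit of weighted addition gates over `F`, of unbounded fan-in, with input nodes indexed by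
`ι` and pairwise distinct output gates indexed by `κ`. A node is an input `Sum.inl i` or a gate
`Sum.inr g`; the gate `g` has one wire from each node `v ∈ wires g`, with the fixed coefficient
`weight g v`. The wires form a finite directed acyclic graph. -/
structure LinearCircuit (F : Type*) (ι κ : Type) where
  Gate : Type
  gateFintype : Fintype Gate
  wires : Gate → Finset (ι ⊕ Gate)
  weight : Gate → ι ⊕ Gate → F
  acyclic : WellFounded (fun h g : Gate => Sum.inr h ∈ wires g)
  output : κ ↪ Gate

namespace LinearCircuit

variable {F : Type*} {ι κ : Type}

/-- The value of a gate on the input `x`, by recursion along the wires. -/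
def gateValue [Field F] (C : LinearCircuit F ι κ) (x : ι → F) : C.Gate → F :=
  C.acyclic.fix fun g ih =>
    ∑ v ∈ (C.wires g).attach, C.weight g v.1 *
      (match v with
        | ⟨Sum.inl i, _⟩ => x i
        | ⟨Sum.inr h, hh⟩ => ih h hh)

/-- The value of a node (an input or a gate) on the input `x`. -/
def nodeValue [Field F] (C : LinearCircuit F ι κ) (x : ι → F) : ι ⊕ C.Gate → F :=
  Sum.elim x (C.gateValue x)

/-- A gate computes the weighted sum of the nodes that are wired to it. -/
theorem gateValue_eq [Field F] (C : LinearCircuit F ι κ) (x : ι → F) (g : C.Gate) :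
    C.gateValue x g = ∑ v ∈ C.wires g, C.weight g v * C.nodeValue x v := by
  rw [gateValue, WellFounded.fix_eq, ← Finset.sum_attach (C.wires g)]
  refine Finset.sum_congr rfl ?_
  rintro ⟨v, hv⟩ -
  cases v <;> rfl

/-- The map computed by the circuit. -/
def eval [Field F] (C : LinearCircuit F ι κ) (x : ι → F) : κ → F :=
  fun j => C.gateValue x (C.output j)

/-- The fan-in of a gate. -/
def fanIn (C : LinearCircuit F ι κ) (g : C.Gate) : ℕ := (C.wires g).card

/-- The size: the total number of wires. -/
def size (C : LinearCircuit F ι κ) : ℕ :=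
  letI := C.gateFintype
  ∑ g : C.Gate, C.fanIn g

/-- `C.IsPath u v l`: there is a directed path of length `l` (with `l` wires) from `u` to `v`. -/
inductive IsPath (C : LinearCircuit F ι κ) : ι ⊕ C.Gate → ι ⊕ C.Gate → ℕ → Prop
  | nil (u : ι ⊕ C.Gate) : IsPath C u u 0
  | snoc {u v : ι ⊕ C.Gate} {g : C.Gate} {l : ℕ} :
      IsPath C u v l → v ∈ C.wires g → IsPath C u (Sum.inr g) (l + 1)

/-- The depth: the length of a longest path from an input to an output. -/
noncomputable def depth (C : LinearCircuit F ι κ) : ℕ∞ :=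
  ⨆ (i : ι) (j : κ) (l : ℕ) (_ : C.IsPath (Sum.inl i) (Sum.inr (C.output j)) l), (l : ℕ∞)

/-- The circuit computes the linear map `L`. -/
def Computes [Field F] (C : LinearCircuit F ι κ) (L : (ι → F) →ₗ[F] (κ → F)) : Prop :=
  ∀ x : ι → F, C.eval x = L x

end LinearCircuit

/-- An `(n, r, s)`-partial good code: a linear map that sends every nonzero vector of Hamming weight
in `[r, s]` to a vector of Hamming weight at least `4 n`. -/
def IsPartialGoodCode {F : Type*} [Field F] [DecidableEq F] (n : ℕ) (r s : ℝ)
    (L : (Fin n → F) →ₗ[F] (Fin (32 * n) → F)) : Prop :=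
  ∀ x : Fin n → F, x ≠ 0 → r ≤ (hammingNorm x : ℝ) → (hammingNorm x : ℝ) ≤ s →
    4 * n ≤ hammingNorm (L x)

/-- `f^*(n) = min {i : f^{(i)}(n) ≤ 1}`. -/
noncomputable def iterStar (f : ℕ → ℕ) (n : ℕ) : ℕ := sInf {i : ℕ | f^[i] n ≤ 1}

/-- The inverse Ackermann hierarchy: `λ_1(n) = ⌊√n⌋`, `λ_2(n) = ⌈log₂ n⌉` and
`λ_d(n) = λ_{d-2}^*(n)` for `d ≥ 3`. The index `0` is not used. -/
noncomputable def lam : ℕ → ℕ → ℕ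
  | 0 => id
  | 1 => Nat.sqrt
  | 2 => Nat.clog 2
  | d + 3 => iterStar (lam (d + 1))

/-- The Ackermann function `A(i, j)`, for `j ≥ 1`. The argument `j = 0` is not used. -/
def ackA : ℕ → ℕ → ℕ
  | 0, j => 2 * j
  | _ + 1, 0 => 0
  | _ + 1, 1 => 2
  | i + 1, j + 2 => ackA i (ackA (i + 1) (j + 1))
termination_by i j => (i, j)

/-! Two random constructions carry the proof. A condenser (`exists_condenser`) is the adjacency map
of a random bipartite graph of left degree `2 a + 3` that expands small sets by `a + 2`, more than
half the degree. The support of a light vector then has as many unique neighbours as elements, so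
its weight does not drop although there are fewer coordinates. An amplifier (`exists_amplifier`) is
a layer of random sparse rows: if one block of the intermediate vector has relative weight `1 / ρ`,
rows sampling `O(q ρ)` entries per block give weight `4 n`, by a union bound over `q ^ n` vectors.

Condensing at `L` dyadic scales and amplifying gives depth 2 and `O(m L ^ 2)` wires
(`exists_baseCode`). For weights from `n / a` to `n / r`, put `s = 46656 r ^ 2`
(`exists_code_of_inner`). Weights above `n / s ^ 2` are condensed to about `n / √r` coordinates and
given a base code with `L = O(log r)`, of linear size as `log² r = O(√r)`. Smaller weights are
condensed to about `n / s` coordinates and given an inner code. This adds depth 2 and keeps the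
output fan-in bounded.

The inner code comes from the previous level: the ranges from `n / A(k, ρ)` to `n / ρ`, with `ρ`
running through values of `A(k + 1, ·)`, cover all weights at least `n / r` by `λ(r)` linear-size
codes (`exists_code_of_ranges`). Bounded output fan-in lets their combination cost no depth. With
`A(k + 1, r)` as threshold there are at most `r` ranges, paid for by the length `n / s`, so the
constant does not grow with `k`. -/

namespace LinearCircuit

variable {F : Type*} {ι μ κ : Type}

/-! ### Composition of circuits: levels, series, parallel and merged layers. -/

section Nodes

variable {I : Type} {K : I → Type}

theorem wellFounded_of_level {G : Type} {w : G → Finset (ι ⊕ G)} (lev : G → ℕ)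
    (h : ∀ g h, Sum.inr h ∈ w g → lev h < lev g) :
    WellFounded (fun h g : G => Sum.inr h ∈ w g) :=
  Subrelation.wf (fun {a b} hab => h b a hab) (measure lev).wf

/-- The nodes of the second circuit in a serial composition. -/
def compEmb (C₁ : LinearCircuit F ι μ) (C₂ : LinearCircuit F μ κ) :
    μ ⊕ C₂.Gate ↪ ι ⊕ (C₁.Gate ⊕ C₂.Gate) :=
  ⟨Sum.elim (fun m => Sum.inr (Sum.inl (C₁.output m))) (fun g => Sum.inr (Sum.inr g)), by
    rintro (a | a) (b | b) h <;> simp_all⟩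

/-- The inclusion of the nodes of a circuit when further gates are added. -/
def addEmb (C : LinearCircuit F ι μ) (H : Type) : ι ⊕ C.Gate ↪ ι ⊕ (C.Gate ⊕ H) :=
  ⟨Sum.map id Sum.inl, by rintro (a | a) (b | b) h <;> simp_all⟩

theorem compEmb_inl (C₁ : LinearCircuit F ι μ) (C₂ : LinearCircuit F μ κ) (m : μ) :
    compEmb C₁ C₂ (Sum.inl m) = Sum.inr (Sum.inl (C₁.output m)) := rfl

theorem compEmb_inr (C₁ : LinearCircuit F ι μ) (C₂ : LinearCircuit F μ κ) (g : C₂.Gate) :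
    compEmb C₁ C₂ (Sum.inr g) = Sum.inr (Sum.inr g) := rfl

theorem addEmb_inl (C : LinearCircuit F ι μ) (H : Type) (i : ι) :
    addEmb C H (Sum.inl i) = Sum.inl i := rfl

theorem addEmb_inr (C : LinearCircuit F ι μ) (H : Type) (g : C.Gate) :
    addEmb C H (Sum.inr g) = Sum.inr (Sum.inl g) := rfl

/-- The inclusion of the nodes of one circuit of a family. -/
def sigmaEmb (C : ∀ i, LinearCircuit F ι (K i)) (i : I) :
    ι ⊕ (C i).Gate ↪ ι ⊕ (Σ i, (C i).Gate) :=
  ⟨Sum.map id fun g => ⟨i, g⟩, by rintro (a | a) (b | b) h <;> simp_all⟩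

theorem sigmaEmb_inl (C : ∀ i, LinearCircuit F ι (K i)) (i : I) (a : ι) :
    sigmaEmb C i (Sum.inl a) = Sum.inl a := rfl

theorem sigmaEmb_inr (C : ∀ i, LinearCircuit F ι (K i)) (i : I) (g : (C i).Gate) :
    sigmaEmb C i (Sum.inr g) = Sum.inr ⟨i, g⟩ := rfl

/-- The inputs of the second circuit become outputs of the first, at level at most `d`, so shifting
its levels by `d` suffices. -/
theorem comp_level_lt (C₁ : LinearCircuit F ι μ) (C₂ : LinearCircuit F μ κ)
    {lev₁ : C₁.Gate → ℕ} {lev₂ : C₂.Gate → ℕ} {d : ℕ}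
    (h₁ : ∀ g h, Sum.inr h ∈ C₁.wires g → lev₁ h < lev₁ g)
    (h₂ : ∀ g h, Sum.inr h ∈ C₂.wires g → lev₂ h < lev₂ g)
    (p₂ : ∀ g, 1 ≤ lev₂ g) (hd : ∀ j, lev₁ (C₁.output j) ≤ d) (g h : C₁.Gate ⊕ C₂.Gate)
    (hh : Sum.inr h ∈ Sum.elim (fun g => (C₁.wires g).map (addEmb C₁ C₂.Gate))
      (fun g => (C₂.wires g).map (compEmb C₁ C₂)) g) :
    Sum.elim lev₁ (fun g => d + lev₂ g) h < Sum.elim lev₁ (fun g => d + lev₂ g) g := by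
  cases g with
  | inl g =>
    simp only [Sum.elim_inl, Finset.mem_map] at hh
    obtain ⟨(a | a), ha, hb⟩ := hh
    · simp [addEmb_inl] at hb
    · simp only [addEmb_inr, Sum.inr.injEq] at hb
      subst hb
      exact h₁ g a ha
  | inr g =>
    simp only [Sum.elim_inr, Finset.mem_map] at hh
    obtain ⟨(a | a), ha, hb⟩ := hh
    · simp only [compEmb_inl, Sum.inr.injEq] at hb
      subst hb
      have := hd a
      have := p₂ g
      simp only [Sum.elim_inl, Sum.elim_inr]
      omega
    · simp only [compEmb_inr, Sum.inr.injEq] at hb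
      subst hb
      have := h₂ g a ha
      simp only [Sum.elim_inr]
      omega

/-- Inputs count as level `0`, and each wire raises the level by at least one. Levels thus replace
path lengths in all depth bounds. -/
theorem IsPath.le_level {C : LinearCircuit F ι κ} {lev : C.Gate → ℕ}
    (h₁ : ∀ g h, Sum.inr h ∈ C.wires g → lev h < lev g) (h₂ : ∀ g, 1 ≤ lev g)
    {i : ι} {v : ι ⊕ C.Gate} {l : ℕ} (h : C.IsPath (Sum.inl i) v l) :
    l ≤ Sum.elim (fun _ => 0) lev v := by
  generalize hu : (Sum.inl i : ι ⊕ C.Gate) = u at h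
  induction h with
  | nil => exact Nat.zero_le _
  | @snoc v g l _ hv ih =>
    cases v with
    | inl a =>
      have := h₂ g
      simp only [Sum.elim_inl, Sum.elim_inr] at ih ⊢
      omega
    | inr a =>
      have := h₁ g a hv
      simp only [Sum.elim_inr] at ih ⊢
      omega

end Nodes

variable [Field F]

/-- A solution of the gate equations is the gate value. -/
theorem gateValue_unique (C : LinearCircuit F ι κ) (x : ι → F) (v : C.Gate → F)
    (hv : ∀ g, v g = ∑ u ∈ C.wires g, C.weight g u * Sum.elim x v u) (g : C.Gate) :
    C.gateValue x g = v g := by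
  induction g using C.acyclic.induction with
  | _ g ih =>
    rw [gateValue_eq, hv g]
    refine Finset.sum_congr rfl fun u hu => ?_
    cases u with
    | inl i => rfl
    | inr h => simp only [nodeValue, Sum.elim_inr, ih h hu]

/-- The circuit `C` computes `L`, and some levelling of its gates shows that its depth is at most
`d`; its size is at most `s` and the fan-in of its outputs is at most `D`. -/
def Realizes (L : (ι → F) →ₗ[F] (κ → F)) (d s D : ℕ) : Prop :=
  ∃ (C : LinearCircuit F ι κ) (lev : C.Gate → ℕ),
    (∀ g h, Sum.inr h ∈ C.wires g → lev h < lev g) ∧ (∀ g, 1 ≤ lev g) ∧ C.Computes L ∧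
    (∀ j, lev (C.output j) ≤ d) ∧ C.size ≤ s ∧ ∀ j, C.fanIn (C.output j) ≤ D

theorem Realizes.exists_circuit {L : (ι → F) →ₗ[F] (κ → F)} {d s D : ℕ} (h : Realizes L d s D) :
    ∃ C : LinearCircuit F ι κ, C.Computes L ∧ C.depth ≤ ((d : ℕ) : ℕ∞) ∧ C.size ≤ s ∧
      ∀ j, C.fanIn (C.output j) ≤ D := by
  obtain ⟨C, lev, h₁, h₂, hL, hd, hs, hD⟩ := h
  refine ⟨C, hL, ?_, hs, hD⟩
  refine iSup_le fun i => iSup_le fun j => iSup_le fun l => iSup_le fun hp => ?_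
  exact_mod_cast (hp.le_level h₁ h₂).trans (hd j)

theorem Realizes.mono {L : (ι → F) →ₗ[F] (κ → F)} {d s D d' s' D' : ℕ} (h : Realizes L d s D)
    (hd : d ≤ d') (hs : s ≤ s') (hD : D ≤ D') : Realizes L d' s' D' := by
  obtain ⟨C, lev, h₁, h₂, hL, h₃, h₄, h₅⟩ := h
  exact ⟨C, lev, h₁, h₂, hL, fun j => (h₃ j).trans hd, h₄.trans hs, fun j => (h₅ j).trans hD⟩

section Layer

variable [Fintype ι] [Fintype κ] [DecidableEq F]

/-- The circuit with one layer of gates, whose wires are the nonzero entries of a matrix. -/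
def layer (A : Matrix κ ι F) : LinearCircuit F ι κ where
  Gate := κ
  gateFintype := inferInstance
  wires j := (Finset.univ.filter fun i => A j i ≠ 0).map Function.Embedding.inl
  weight j := Sum.elim (A j) 0
  acyclic := wellFounded_of_level (fun _ => 0) fun g h hh => by simp at hh
  output := Function.Embedding.refl _

theorem realizes_mulVecLin (A : Matrix κ ι F) (s D : ℕ)
    (hs : ∑ j, (Finset.univ.filter fun i => A j i ≠ 0).card ≤ s)
    (hD : ∀ j, (Finset.univ.filter fun i => A j i ≠ 0).card ≤ D) :
    Realizes A.mulVecLin 1 s D := by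
  refine ⟨layer A, fun _ => 1, fun g h hh => ?_, fun _ => le_rfl, fun x => ?_, fun _ => le_rfl,
    ?_, fun j => ?_⟩
  · obtain ⟨a, -, ha⟩ := Finset.mem_map.1 hh
    exact absurd ha Sum.inl_ne_inr
  · funext j
    refine (gateValue_unique (layer A) x (A.mulVecLin x) (fun g => ?_) j)
    simp only [layer, Finset.sum_map, Function.Embedding.inl_apply, Sum.elim_inl,
      Matrix.mulVecLin_apply, Matrix.mulVec, dotProduct]
    rw [Finset.sum_filter_of_ne]
    intro i _ h0 h1
    exact h0 (by rw [h1, zero_mul])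
  · refine le_trans (le_of_eq ?_) hs
    exact Finset.sum_congr rfl fun j _ => Finset.card_map _
  · exact (Finset.card_map _).trans_le (hD j)

end Layer

section Comp

/-- The outputs of the first circuit are identified with the inputs of the second, so no wires are
added. -/
theorem Realizes.comp {L₁ : (ι → F) →ₗ[F] (μ → F)} {L₂ : (μ → F) →ₗ[F] (κ → F)}
    {d₁ s₁ D₁ d₂ s₂ D₂ : ℕ} (H₁ : Realizes L₁ d₁ s₁ D₁) (H₂ : Realizes L₂ d₂ s₂ D₂) :
    Realizes (L₂ ∘ₗ L₁) (d₁ + d₂) (s₁ + s₂) D₂ := by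
  obtain ⟨C₁, lev₁, h₁, p₁, c₁, e₁, hs₁, -⟩ := H₁
  obtain ⟨C₂, lev₂, h₂, p₂, c₂, e₂, hs₂, hD₂⟩ := H₂
  let _ := C₁.gateFintype
  let _ := C₂.gateFintype
  have hlev := comp_level_lt C₁ C₂ h₁ h₂ p₂ e₁
  let C : LinearCircuit F ι κ :=
    { Gate := C₁.Gate ⊕ C₂.Gate
      gateFintype := inferInstance
      wires := Sum.elim (fun g => (C₁.wires g).map (addEmb C₁ C₂.Gate))
        (fun g => (C₂.wires g).map (compEmb C₁ C₂))
      weight := Sum.elim (fun g => Function.extend (addEmb C₁ C₂.Gate) (C₁.weight g) 0)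
        (fun g => Function.extend (compEmb C₁ C₂) (C₂.weight g) 0)
      acyclic := wellFounded_of_level _ hlev
      output := C₂.output.trans Function.Embedding.inr }
  refine ⟨C, Sum.elim lev₁ (fun g => d₁ + lev₂ g), hlev, ?_, fun x => ?_, fun j => ?_, ?_,
    fun j => ?_⟩
  · rintro (g | g)
    · exact p₁ g
    · exact (p₂ g).trans (Nat.le_add_left _ _)
  · funext j
    refine (gateValue_unique C x (Sum.elim (C₁.gateValue x) (C₂.gateValue (C₁.eval x))) ?_
      (Sum.inr (C₂.output j))).trans ?_
    · rintro (g | g)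
      · simp only [C, Sum.elim_inl, Finset.sum_map]
        rw [gateValue_eq]
        refine Finset.sum_congr rfl fun u _ => ?_
        rw [(addEmb C₁ C₂.Gate).injective.extend_apply]
        cases u <;> rfl
      · simp only [C, Sum.elim_inr, Finset.sum_map]
        rw [gateValue_eq]
        refine Finset.sum_congr rfl fun u _ => ?_
        rw [(compEmb C₁ C₂).injective.extend_apply]
        cases u <;> rfl
    · rw [Sum.elim_inr, LinearMap.comp_apply, ← c₂, ← c₁]
      rfl
  · exact Nat.add_le_add_left (e₂ j) _
  · have : C.size = C₁.size + C₂.size := by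
      simp [size, fanIn, C, Fintype.sum_sum_type]
    omega
  · simpa [fanIn, C] using hD₂ j

end Comp

section Parallel

variable {I : Type} {K : I → Type}

/-- The linear map into a disjoint union of index sets assembled from its blocks. -/
def sigmaMap (L : ∀ i, (ι → F) →ₗ[F] (K i → F)) : (ι → F) →ₗ[F] ((Σ i, K i) → F) :=
  LinearMap.pi fun p => LinearMap.proj p.2 ∘ₗ L p.1

theorem Realizes.sigma [Fintype I] {L : ∀ i, (ι → F) →ₗ[F] (K i → F)} {d D : ℕ} {s : I → ℕ}
    (H : ∀ i, Realizes (L i) d (s i) D) : Realizes (sigmaMap L) d (∑ i, s i) D := by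
  choose C lev h₁ h₂ hc hd hs hD using H
  let _ := fun i => (C i).gateFintype
  have hlev : ∀ g h : (Σ i, (C i).Gate),
      Sum.inr h ∈ ((C g.1).wires g.2).map (sigmaEmb C g.1) → lev h.1 h.2 < lev g.1 g.2 := by
    rintro ⟨i, g⟩ h hh
    simp only [Finset.mem_map] at hh
    obtain ⟨(a | a), ha, hb⟩ := hh
    · simp [sigmaEmb_inl] at hb
    · simp only [sigmaEmb_inr, Sum.inr.injEq] at hb
      subst hb
      exact h₁ i g a ha
  let E : LinearCircuit F ι (Σ i, K i) :=
    { Gate := Σ i, (C i).Gate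
      gateFintype := inferInstance
      wires := fun g => ((C g.1).wires g.2).map (sigmaEmb C g.1)
      weight := fun g => Function.extend (sigmaEmb C g.1) ((C g.1).weight g.2) 0
      acyclic := wellFounded_of_level _ hlev
      output := ⟨fun p => ⟨p.1, (C p.1).output p.2⟩, by
        rintro ⟨i, a⟩ ⟨j, b⟩ h
        simp only [Sigma.mk.injEq] at h
        obtain ⟨rfl, h⟩ := h
        rw [(C i).output.injective (eq_of_heq h)]⟩ }
  refine ⟨E, fun g => lev g.1 g.2, hlev, fun g => h₂ g.1 g.2, fun x => ?_, fun j => hd j.1 j.2, ?_,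
    fun j => ?_⟩
  · funext j
    refine (gateValue_unique E x (fun g => (C g.1).gateValue x g.2) ?_
      ⟨j.1, (C j.1).output j.2⟩).trans ?_
    · rintro ⟨i, g⟩
      simp only [E, Finset.sum_map]
      rw [gateValue_eq]
      refine Finset.sum_congr rfl fun u _ => ?_
      rw [(sigmaEmb C i).injective.extend_apply]
      cases u <;> rfl
    · exact congrFun (hc j.1 x) j.2
  · have : E.size = ∑ i, (C i).size := by
      simp [size, fanIn, E, Fintype.sum_sigma]
    rw [this]
    exact Finset.sum_le_sum fun i _ => hs i
  · exact (Finset.card_map _).trans_le (hD j.1 j.2)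

end Parallel

section Merge

variable [Fintype μ] [Fintype κ] [DecidableEq F]

/-- A layer on top of outputs of bounded fan-in costs no depth: its gates read the wires of the
outputs. -/
theorem Realizes.merge {L : (ι → F) →ₗ[F] (μ → F)} {d s D e : ℕ} (H : Realizes L d s D)
    (hd1 : 1 ≤ d) (A : Matrix κ μ F) (hA : ∀ j, (Finset.univ.filter fun i => A j i ≠ 0).card ≤ e) :
    Realizes (A.mulVecLin ∘ₗ L) d (s + Fintype.card κ * (e * D)) (e * D) := by
  classical
  obtain ⟨C, lev, h₁, h₂, hc, hd, hs, hD⟩ := H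
  let _ := C.gateFintype
  let S : κ → Finset μ := fun j => Finset.univ.filter fun i => A j i ≠ 0
  let W : κ → Finset (ι ⊕ C.Gate) := fun j => (S j).biUnion fun m => C.wires (C.output m)
  have hW : ∀ j, (W j).card ≤ e * D := fun j =>
    (Finset.card_biUnion_le_card_mul _ _ D fun m _ => hD m).trans (Nat.mul_le_mul_right _ (hA j))
  have hlev : ∀ g h : C.Gate ⊕ κ,
      Sum.inr h ∈ Sum.elim (fun g => (C.wires g).map (addEmb C κ))
        (fun j => (W j).map (addEmb C κ)) g →
      -- A new gate sits at the highest level among the outputs it replaces; the `max 1` covers an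
      -- empty row.
      Sum.elim lev (fun j => max 1 ((S j).sup fun m => lev (C.output m))) h <
        Sum.elim lev (fun j => max 1 ((S j).sup fun m => lev (C.output m))) g := by
    rintro (g | g) h hh
    · simp only [Sum.elim_inl, Finset.mem_map] at hh
      obtain ⟨(a | a), ha, hb⟩ := hh
      · simp [addEmb_inl] at hb
      · simp only [addEmb_inr, Sum.inr.injEq] at hb
        subst hb
        exact h₁ g a ha
    · simp only [Sum.elim_inr, Finset.mem_map] at hh
      obtain ⟨(a | a), ha, hb⟩ := hh
      · simp [addEmb_inl] at hb
      · simp only [addEmb_inr, Sum.inr.injEq] at hb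
        subst hb
        obtain ⟨m, hm, ham⟩ := Finset.mem_biUnion.1 ha
        exact (h₁ _ a ham).trans_le
          ((Finset.le_sup (f := fun m => lev (C.output m)) hm).trans (le_max_right _ _))
  -- Several of the outputs read by `j` may share a wire source; their coefficients are added.
  let w : κ → ι ⊕ C.Gate → F := fun j u =>
    ∑ m ∈ S j, A j m * if u ∈ C.wires (C.output m) then C.weight (C.output m) u else 0
  let E : LinearCircuit F ι κ :=
    { Gate := C.Gate ⊕ κ
      gateFintype := inferInstance
      wires := Sum.elim (fun g => (C.wires g).map (addEmb C κ)) (fun j => (W j).map (addEmb C κ))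
      weight := Sum.elim (fun g => Function.extend (addEmb C κ) (C.weight g) 0)
        (fun j => Function.extend (addEmb C κ) (w j) 0)
      acyclic := wellFounded_of_level _ hlev
      output := Function.Embedding.inr }
  have hnode : ∀ (x : ι → F) (u : ι ⊕ C.Gate),
      Sum.elim x (Sum.elim (C.gateValue x) (A.mulVecLin (L x))) (addEmb C κ u) =
        C.nodeValue x u := by
    rintro x (u | u) <;> rfl
  refine ⟨E, _, hlev, ?_, fun x => ?_, fun j => ?_, ?_, fun j => ?_⟩
  · rintro (g | j)
    · exact h₂ g
    · exact le_max_left _ _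
  · funext j
    refine gateValue_unique E x (Sum.elim (C.gateValue x) (A.mulVecLin (L x))) ?_ (Sum.inr j)
    rintro (g | j)
    · simp only [E, Sum.elim_inl, Finset.sum_map, hnode]
      rw [gateValue_eq]
      refine Finset.sum_congr rfl fun u _ => ?_
      rw [(addEmb C κ).injective.extend_apply]
    · simp only [E, Sum.elim_inr, Finset.sum_map, hnode, (addEmb C κ).injective.extend_apply]
      have h1 : A.mulVecLin (L x) j = ∑ m ∈ S j, A j m * L x m := by
        simp only [Matrix.mulVecLin_apply, Matrix.mulVec, dotProduct, S]
        rw [Finset.sum_filter_of_ne]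
        intro i _ h0 h1
        exact h0 (by rw [h1, zero_mul])
      rw [h1]
      simp only [w, Finset.sum_mul]
      rw [Finset.sum_comm]
      refine Finset.sum_congr rfl fun m hm => ?_
      have h2 : L x m = C.gateValue x (C.output m) := (congrFun (hc x) m).symm
      rw [h2, gateValue_eq, Finset.mul_sum]
      have h3 : C.wires (C.output m) ⊆ W j := Finset.subset_biUnion_of_mem
        (fun m => C.wires (C.output m)) hm
      rw [← Finset.sum_subset h3]
      · refine Finset.sum_congr rfl fun u hu => ?_
        rw [if_pos hu, mul_assoc]
      · intro u _ hu
        rw [if_neg hu, mul_zero, zero_mul]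
  · exact max_le hd1 (Finset.sup_le fun m _ => hd m)
  · have h1 : E.size = C.size + ∑ j, (W j).card := by
      simp [size, fanIn, E, Fintype.sum_sum_type]
    have h2 : ∑ j, (W j).card ≤ Fintype.card κ * (e * D) := by
      simpa using Finset.sum_le_card_nsmul Finset.univ (fun j => (W j).card) _ fun j _ => hW j
    omega
  · simpa [fanIn, E] using hW j

end Merge

end LinearCircuit

/-! ### Random sparse rows and amplifiers. -/

open scoped Classical in
/-- A random choice of `32 n` rows, each of which misses a given target with probability at most
`11 / (10 q)`, hits each of at most `q ^ n` targets with at least `4 n` rows. -/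
theorem exists_rows {Ω T : Type*} [Fintype Ω] [Nonempty Ω] (P : Ω → T → Prop) (X : Finset T)
    {q n : ℕ} (hq : 2 ≤ q) (hn : 1 ≤ n) (hX : X.card ≤ q ^ n)
    (hP : ∀ x ∈ X, 10 * q * (Finset.univ.filter fun ω => ¬ P ω x).card ≤ 11 * Fintype.card Ω) :
    ∃ f : Fin (32 * n) → Ω, ∀ x ∈ X, 4 * n ≤ (Finset.univ.filter fun j => P (f j) x).card := by
  by_contra! hcon
  have hq0 : (0 : ℝ) < q := by exact_mod_cast (by omega : 0 < q)
  have hΩ : (0 : ℝ) < Fintype.card Ω := by exact_mod_cast Fintype.card_pos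
  set z : ℝ := 1 / (4 * q) with hz
  have hz0 : 0 < z := by positivity
  have hz1 : z ≤ 1 := by
    rw [hz, div_le_one (by positivity)]
    have : (2 : ℝ) ≤ q := by exact_mod_cast hq
    linarith
  -- Exponential moment: `z ^ (number of hits)` has mean at most `(1 / (4 q) + 11 / (10 q)) ^ (32
  -- n)`, which is `(27 / (20 q)) ^ (32 n)`. Failure of every `f` would force `z ^ 4 ≤ q (27 / (20
  -- q)) ^ 32`.
  let w : Ω → T → ℝ := fun ω x => if P ω x then z else 1
  have hw0 : ∀ ω x, 0 ≤ w ω x := fun ω x => by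
    simp only [w]; split_ifs <;> positivity
  have hprod : ∀ (f : Fin (32 * n) → Ω) x,
      ∏ j, w (f j) x = z ^ (Finset.univ.filter fun j => P (f j) x).card := fun f x => by
    simp only [w]
    rw [Finset.prod_ite]
    simp
  have hlow : (Fintype.card Ω : ℝ) ^ (32 * n) * z ^ (4 * n) ≤
      ∑ f : Fin (32 * n) → Ω, ∑ x ∈ X, ∏ j, w (f j) x := by
    have h1 : ∑ _f : Fin (32 * n) → Ω, z ^ (4 * n) =
        (Fintype.card Ω : ℝ) ^ (32 * n) * z ^ (4 * n) := by
      simp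
    rw [← h1]
    refine Finset.sum_le_sum fun f _ => ?_
    obtain ⟨x, hx, hlt⟩ := hcon f
    refine le_trans ?_ (Finset.single_le_sum (f := fun x => ∏ j, w (f j) x)
      (fun x _ => Finset.prod_nonneg fun j _ => hw0 _ _) hx)
    rw [hprod]
    exact pow_le_pow_of_le_one hz0.le hz1 hlt.le
  have hup : ∑ f : Fin (32 * n) → Ω, ∑ x ∈ X, ∏ j, w (f j) x ≤
      (q : ℝ) ^ n * ((Fintype.card Ω : ℝ) * (27 / (20 * q))) ^ (32 * n) := by
    rw [Finset.sum_comm]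
    have h1 : ∀ x ∈ X, ∑ f : Fin (32 * n) → Ω, ∏ j, w (f j) x ≤
        ((Fintype.card Ω : ℝ) * (27 / (20 * q))) ^ (32 * n) := fun x hx => by
      rw [← Fintype.sum_pow fun ω => w ω x]
      refine pow_le_pow_left₀ (Finset.sum_nonneg fun ω _ => hw0 _ _) ?_ _
      have h2 : ∑ ω, w ω x ≤ ∑ ω, (z + if ¬ P ω x then 1 else 0) := by
        refine Finset.sum_le_sum fun ω _ => ?_
        simp only [w]
        by_cases h : P ω x <;> simp [h, hz0.le]
      refine h2.trans ?_
      rw [Finset.sum_add_distrib, Finset.sum_boole]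
      have h3 : (10 * q * (Finset.univ.filter fun ω => ¬ P ω x).card : ℝ) ≤
          11 * Fintype.card Ω := by exact_mod_cast hP x hx
      have h4 : ((Finset.univ.filter fun ω => ¬ P ω x).card : ℝ) ≤
          11 * Fintype.card Ω / (10 * q) := by
        rw [le_div_iff₀ (by positivity)]; linarith
      simp only [Finset.sum_const, Finset.card_univ, nsmul_eq_mul]
      refine (add_le_add_right h4 _).trans (le_of_eq ?_)
      rw [hz]; field_simp; norm_num
    refine (Finset.sum_le_card_nsmul _ _ _ h1).trans ?_
    rw [nsmul_eq_mul]
    gcongr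
    exact_mod_cast hX
  have h := hlow.trans hup
  rw [mul_pow, mul_left_comm] at h
  have h := le_of_mul_le_mul_left h (by positivity)
  rw [pow_mul, pow_mul, ← mul_pow] at h
  refine absurd h (not_le.2 (pow_lt_pow_left₀ ?_ (by positivity) (by omega)))
  rw [hz, div_pow, div_pow, mul_pow, mul_pow, one_pow, lt_div_iff₀ (by positivity)]
  have h5 : (2 : ℝ) ^ 27 ≤ (q : ℝ) ^ 27 := by
    gcongr; exact_mod_cast hq
  have h6 : (q : ℝ) * (27 ^ 32 / (20 ^ 32 * q ^ 32)) * (4 ^ 4 * q ^ 4) =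
      (27 ^ 32 / 20 ^ 32 * 4 ^ 4) / q ^ 27 := by
    field_simp
  rw [h6, div_lt_one (by positivity)]
  refine lt_of_lt_of_le ?_ h5
  norm_num

section

variable {F : Type*} [Field F] [Fintype F] [DecidableEq F]

/-- A nonzero linear functional vanishes on at most a `1 / q` fraction of the space. -/
theorem card_mul_card_zeros_le {J : Type*} [Fintype J] [DecidableEq J] (v : J → F) {a : J}
    (ha : v a ≠ 0) :
    Fintype.card F * (Finset.univ.filter fun c : J → F => ∑ b, c b * v b = 0).card ≤
      Fintype.card F ^ Fintype.card J := by
  rw [← Fintype.card_fun, ← Finset.card_univ (α := F), ← Finset.card_product,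
    ← Finset.card_univ (α := J → F)]
  -- The translates of the kernel along the coordinate `a` are pairwise disjoint.
  refine Finset.card_le_card_of_injOn (fun p => p.2 + Pi.single a p.1) (fun _ _ => by simp) ?_
  rintro ⟨t, c⟩ h ⟨t', c'⟩ h' heq
  simp only [Finset.coe_product, Set.mem_prod, Finset.coe_filter, Set.mem_ofPred_eq,
    Finset.mem_univ, true_and] at h h'
  have key : ∀ (t : F) (c : J → F), ∑ b, (c + Pi.single a t : J → F) b * v b = ∑ b, c b * v b + t * v a :=
    fun t c => by
      simp only [Pi.add_apply, add_mul, Finset.sum_add_distrib]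
      congr 1
      rw [Finset.sum_eq_single a] <;> simp +contextual
  have h1 : ∑ b, (c + Pi.single a t : J → F) b * v b =
      ∑ b, (c' + Pi.single a t' : J → F) b * v b := congrArg (fun c : J → F => ∑ b, c b * v b) heq
  rw [key, key, h.2, h'.2, zero_add, zero_add] at h1
  have ht : t = t' := mul_right_cancel₀ ha h1
  subst ht
  simpa using heq

/-- The fraction of random sparse rows `(p, c)` that vanish on a vector given in blocks. -/
theorem card_rows_zero_le {J : Type*} [Fintype J] [DecidableEq J] {M : J → Type*}
    [∀ a, Fintype (M a)] [∀ a, DecidableEq (M a)] (y : ∀ a, M a → F)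
    (hy : 10 * Fintype.card F * ∏ a, (Finset.univ.filter fun p : M a => y a p = 0).card ≤
      ∏ a, Fintype.card (M a)) :
    10 * Fintype.card F * (Finset.univ.filter fun ω : (∀ a, M a) × (J → F) =>
      ∑ a, ω.2 a * y a (ω.1 a) = 0).card ≤ 11 * Fintype.card ((∀ a, M a) × (J → F)) := by
  set q := Fintype.card F with hq
  have h1 : (Finset.univ.filter fun ω : (∀ a, M a) × (J → F) =>
      ∑ a, ω.2 a * y a (ω.1 a) = 0).card =
      ∑ p : ∀ a, M a, (Finset.univ.filter fun c : J → F => ∑ a, c a * y a (p a) = 0).card := by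
    rw [Finset.card_filter, Fintype.sum_prod_type]
    simp only [Finset.card_filter]
  -- Either all sampled entries vanish, for a `1 / (10 q)` fraction of the `p`, or the random
  -- coefficients cancel with probability at most `1 / q`; the sum is `11 / (10 q)`.
  have h2 : ∀ p : ∀ a, M a,
      q * (Finset.univ.filter fun c : J → F => ∑ a, c a * y a (p a) = 0).card ≤
      (if ∀ a, y a (p a) = 0 then q * q ^ Fintype.card J else 0) + q ^ Fintype.card J := by
    intro p
    split_ifs with h
    · refine (Nat.mul_le_mul_left q (Finset.card_le_univ _)).trans ?_
      rw [Fintype.card_fun]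
      exact Nat.le_add_right _ _
    · push Not at h
      obtain ⟨a, ha⟩ := h
      rw [zero_add]
      exact card_mul_card_zeros_le (fun a => y a (p a)) ha
  have h3 : (Finset.univ.filter fun p : ∀ a, M a => ∀ a, y a (p a) = 0).card =
      ∏ a, (Finset.univ.filter fun p : M a => y a p = 0).card := by
    rw [← Fintype.card_piFinset]
    congr 1
    ext p
    simp
  rw [mul_assoc, h1, Finset.mul_sum, Fintype.card_prod, Fintype.card_pi, Fintype.card_fun]
  refine (Nat.mul_le_mul_left 10 (Finset.sum_le_sum fun p _ => h2 p)).trans ?_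
  rw [Finset.sum_add_distrib, ← Finset.sum_filter, Finset.sum_const, Finset.sum_const, h3,
    Finset.card_univ, Fintype.card_pi, smul_eq_mul, smul_eq_mul]
  calc _ = q ^ Fintype.card J *
        (10 * q * ∏ a, (Finset.univ.filter fun p : M a => y a p = 0).card) +
        10 * ((∏ a, Fintype.card (M a)) * q ^ Fintype.card J) := by ring
    _ ≤ q ^ Fintype.card J * (∏ a, Fintype.card (M a)) +
        10 * ((∏ a, Fintype.card (M a)) * q ^ Fintype.card J) := by gcongr
    _ = _ := by ring

/-- `10 q ρ` samples of a vector with a `1 / ρ` fraction of nonzero entries miss all of them with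
probability at most `1 / (10 q)`. -/
theorem ten_mul_pow_le {q ρ z m : ℕ} (hρ : 1 ≤ ρ) (hm : ρ * z + m ≤ ρ * m) :
    10 * q * z ^ (10 * q * ρ) ≤ m ^ (10 * q * ρ) := by
  have hρ0 : (0 : ℝ) < ρ := by exact_mod_cast hρ
  have hm' : (ρ * z + m : ℝ) ≤ ρ * m := by exact_mod_cast hm
  have h1 : (z : ℝ) ≤ m * Real.exp (-(1 / ρ)) := by
    have h2 : 1 - 1 / (ρ : ℝ) ≤ Real.exp (-(1 / ρ)) := by
      have := Real.add_one_le_exp (-(1 / (ρ : ℝ))); linarith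
    refine le_trans ?_ (mul_le_mul_of_nonneg_left h2 (Nat.cast_nonneg m))
    rw [mul_sub, mul_one, mul_one_div, le_sub_iff_add_le]
    have : (z : ℝ) + m / ρ = (ρ * z + m) / ρ := by field_simp
    rw [this, div_le_iff₀ hρ0]; linarith
  have h3 : (z : ℝ) ^ (10 * q * ρ) ≤ m ^ (10 * q * ρ) * Real.exp (-(10 * q)) := by
    refine (pow_le_pow_left₀ (Nat.cast_nonneg _) h1 _).trans (le_of_eq ?_)
    rw [mul_pow, ← Real.exp_nat_mul]
    congr 2
    push_cast
    field_simp
  have h4 : (10 * q : ℝ) * Real.exp (-(10 * q)) ≤ 1 := by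
    rw [Real.exp_neg, ← div_eq_mul_inv, div_le_one (Real.exp_pos _)]
    have := Real.add_one_le_exp (10 * q : ℝ); linarith
  have : ((10 * q * z ^ (10 * q * ρ) : ℕ) : ℝ) ≤ ((m ^ (10 * q * ρ) : ℕ) : ℝ) := by
    push_cast
    calc (10 * q * z ^ (10 * q * ρ) : ℝ)
        ≤ 10 * q * (m ^ (10 * q * ρ) * Real.exp (-(10 * q))) := by gcongr
      _ = m ^ (10 * q * ρ) * (10 * q * Real.exp (-(10 * q))) := by ring
      _ ≤ m ^ (10 * q * ρ) * 1 := by gcongr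
      _ = _ := mul_one _
  exact_mod_cast this

/-- A sparse layer that amplifies the weight of every vector of `X` to `4 n` out of `32 n`, if one
of the blocks of its image under `G` has a `1 / ρ` fraction of nonzero entries. -/
theorem exists_amplifier {I : Type} [Fintype I] {K : I → Type} [∀ i, Fintype (K i)]
    [∀ i, Nonempty (K i)] {n ρ : ℕ} (hn : 1 ≤ n) (hρ : 1 ≤ ρ)
    (G : (Fin n → F) → ((Σ i, K i) → F)) (X : Set (Fin n → F))
    (hX : ∀ x ∈ X, ∃ i, Fintype.card (K i) ≤ ρ * hammingNorm fun k => G x ⟨i, k⟩) :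
    ∃ A : Matrix (Fin (32 * n)) (Σ i, K i) F,
      (∀ j, (Finset.univ.filter fun i => A j i ≠ 0).card ≤
        Fintype.card I * (10 * Fintype.card F * ρ)) ∧
      ∀ x ∈ X, 4 * n ≤ hammingNorm (A.mulVecLin (G x)) := by
  classical
  set q := Fintype.card F with hq
  have hq2 : 2 ≤ q := Fintype.one_lt_card
  -- Every block is sampled, since the dense one depends on `x`; the miss probability of the other
  -- blocks is bounded by one.
  let J := I × Fin (10 * q * ρ)
  let M : J → Type := fun a => K a.1
  let Ω := (∀ a : J, M a) × (J → F)
  let _ : ∀ a, Fintype (M a) := fun a => inferInstanceAs (Fintype (K a.1))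
  have : ∀ a, Nonempty (M a) := fun a => inferInstanceAs (Nonempty (K a.1))
  let P : Ω → (Fin n → F) → Prop := fun ω x =>
    ∑ a : J, ω.2 a * G x ⟨a.1, ω.1 a⟩ ≠ 0
  obtain ⟨f, hf⟩ := exists_rows P (Finset.univ.filter fun x => x ∈ X) hq2 hn
    ((Finset.card_le_univ _).trans (by simp [hq])) (fun x hx => by
      simp only [P, not_not]
      refine card_rows_zero_le (M := M) (fun a p => G x ⟨a.1, p⟩) ?_
      obtain ⟨i, hi⟩ := hX x (by simpa using hx)
      have hcard : (Finset.univ.filter fun k => G x ⟨i, k⟩ = 0).card +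
          (hammingNorm fun k => G x ⟨i, k⟩) = Fintype.card (K i) := by
        rw [hammingNorm, Finset.card_filter_add_card_filter_not, Finset.card_univ]
      have hgood : 10 * q * (Finset.univ.filter fun k => G x ⟨i, k⟩ = 0).card ^ (10 * q * ρ) ≤
          Fintype.card (K i) ^ (10 * q * ρ) := by
        refine ten_mul_pow_le hρ ?_
        calc _ ≤ ρ * _ + ρ * (hammingNorm fun k => G x ⟨i, k⟩) := Nat.add_le_add_left hi _
          _ = _ := by rw [← mul_add, hcard]
      have hpow : ∀ g : I → ℕ, ∏ a : J, g a.1 = ∏ i, g i ^ (10 * q * ρ) := fun g => by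
        simp [J, Fintype.prod_prod_type]
      refine (congrArg (10 * q * ·)
        (hpow fun i => (Finset.univ.filter fun k => G x ⟨i, k⟩ = 0).card)).trans_le
        (le_of_le_of_eq ?_ (hpow fun i => Fintype.card (K i)).symm)
      rw [← Finset.mul_prod_erase _ _ (Finset.mem_univ i),
        ← Finset.mul_prod_erase Finset.univ (fun i => Fintype.card (K i) ^ (10 * q * ρ))
          (Finset.mem_univ i), ← mul_assoc]
      refine Nat.mul_le_mul hgood (Finset.prod_le_prod' fun b _ => ?_)
      exact Nat.pow_le_pow_left (Finset.card_le_univ _) _)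
  -- Samples may coincide, so an entry is the sum of all coefficients landing on `k`.
  refine ⟨fun j k => ∑ a : J, if (⟨a.1, (f j).1 a⟩ : Σ i, K i) = k then (f j).2 a else 0,
    fun j => ?_, fun x hx => ?_⟩
  · have h1 : (Finset.univ.filter fun k => (∑ a : J,
        if (⟨a.1, (f j).1 a⟩ : Σ i, K i) = k then (f j).2 a else 0) ≠ 0) ⊆
        Finset.univ.image fun a : J => (⟨a.1, (f j).1 a⟩ : Σ i, K i) := by
      intro k hk
      obtain ⟨a, -, ha⟩ := Finset.exists_ne_zero_of_sum_ne_zero (Finset.mem_filter.1 hk).2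
      refine Finset.mem_image.2 ⟨a, Finset.mem_univ _, ?_⟩
      by_contra h
      exact ha (if_neg h)
    refine (Finset.card_le_card h1).trans (Finset.card_image_le.trans ?_)
    simp [J]
  · refine (hf x (by simpa using hx)).trans (le_of_eq ?_)
    rw [hammingNorm]
    congr 1
    ext j
    simp only [Finset.mem_filter, Finset.mem_univ, true_and]
    refine not_congr ?_
    have h1 : ∑ k, (∑ a : J, if (⟨a.1, (f j).1 a⟩ : Σ i, K i) = k then (f j).2 a else 0) * G x k =
        ∑ a : J, (f j).2 a * G x ⟨a.1, (f j).1 a⟩ := by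
      simp only [Finset.sum_mul, ite_mul, zero_mul]
      rw [Finset.sum_comm]
      refine Finset.sum_congr rfl fun a _ => ?_
      rw [Finset.sum_ite_eq, if_pos (Finset.mem_univ _)]
    rw [← h1]
    rfl

end

/-! ### Random expanders. -/

/-- From `w ^ w / w! ≤ e ^ w`, with `e` rounded up to `3`. -/
theorem choose_mul_pow_le (n w : ℕ) : n.choose w * w ^ w ≤ (3 * n) ^ w := by
  have h1 : (w : ℝ) ^ w ≤ 3 ^ w * w.factorial := by
    have h2 := Real.pow_div_factorial_le_exp (w : ℝ) (Nat.cast_nonneg w) w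
    rw [div_le_iff₀ (by positivity)] at h2
    refine h2.trans (mul_le_mul_of_nonneg_right ?_ (Nat.cast_nonneg _))
    have h3 : Real.exp (w : ℝ) = Real.exp 1 ^ w := by rw [← Real.exp_nat_mul, mul_one]
    rw [h3]
    exact pow_le_pow_left₀ (Real.exp_pos 1).le (Real.exp_one_lt_three.le) w
  have h4 : w ^ w ≤ 3 ^ w * w.factorial := by exact_mod_cast h1
  calc n.choose w * w ^ w ≤ n.choose w * (3 ^ w * w.factorial) := Nat.mul_le_mul_left _ h4
    _ = 3 ^ w * (w.factorial * n.choose w) := by ring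
    _ = 3 ^ w * n.descFactorial w := by rw [Nat.descFactorial_eq_factorial_mul_choose]
    _ ≤ 3 ^ w * n ^ w := Nat.mul_le_mul_left _ (Nat.descFactorial_le_pow n w)
    _ = _ := (mul_pow _ _ _).symm

section Expander

variable {n M a K : ℕ}

/-- The union bound over sets `S` of size `w` and targets `T` of size `(a + 2) w`: the probability
that some `S` sends all its edges into some `T` is at most `3 ^ (-w)`. The exponent `a + 4` collects
one `3` for this decay, one from choosing `S` and `a + 2` from choosing `T`. -/
theorem expander_term_le (h : 3 ^ (a + 4) * (a + 2) ^ (a + 1) * n * K ^ a ≤ M ^ (a + 1))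
    {w : ℕ} (hw : 1 ≤ w) (hK : w ≤ K) :
    3 ^ w * (n.choose w * M.choose ((a + 2) * w) * ((a + 2) * w) ^ ((2 * a + 3) * w)) ≤
      M ^ ((2 * a + 3) * w) := by
  refine Nat.le_of_mul_le_mul_left (c := w ^ w) ?_ (by positivity)
  calc w ^ w * (3 ^ w * (n.choose w * M.choose ((a + 2) * w) *
          ((a + 2) * w) ^ ((2 * a + 3) * w)))
      = 3 ^ w * (n.choose w * w ^ w) * (M.choose ((a + 2) * w) *
          ((a + 2) * w) ^ ((a + 2) * w)) * ((a + 2) * w) ^ ((a + 1) * w) := by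
        have : (2 * a + 3) * w = (a + 2) * w + (a + 1) * w := by ring
        rw [this, pow_add]; ring
    _ ≤ 3 ^ w * (3 * n) ^ w * (3 * M) ^ ((a + 2) * w) * ((a + 2) * w) ^ ((a + 1) * w) := by
        gcongr <;> exact choose_mul_pow_le _ _
    _ = (3 ^ (a + 4) * (a + 2) ^ (a + 1) * n * w ^ a * (w * M ^ (a + 2))) ^ w := by
        rw [pow_mul, pow_mul, ← mul_pow, ← mul_pow, ← mul_pow, mul_pow (a + 2) w]; ring
    _ ≤ (M ^ (a + 1) * (w * M ^ (a + 2))) ^ w := by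
        gcongr
        exact (Nat.mul_le_mul_left _ (Nat.pow_le_pow_left hK a)).trans h
    _ = _ := by
        rw [pow_mul, show 2 * a + 3 = (a + 1) + (a + 2) by ring, pow_add, ← mul_pow]; ring

/-- Leaves room to enlarge a too small neighbourhood to exactly `(a + 2) w` vertices. -/
theorem expander_size_le (h : 3 ^ (a + 4) * (a + 2) ^ (a + 1) * n * K ^ a ≤ M ^ (a + 1))
    {w : ℕ} (hK : w ≤ K) (hn : w ≤ n) : (a + 2) * w ≤ M := by
  refine (Nat.pow_le_pow_iff_left (n := a + 1) (by omega)).1 (le_trans ?_ h)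
  calc ((a + 2) * w) ^ (a + 1) = 1 * (a + 2) ^ (a + 1) * w * w ^ a := by
        rw [mul_pow]; ring
    _ ≤ _ := by gcongr; exact Nat.one_le_pow _ _ (by norm_num)

/-- The functions that map all edges of `S` into `T`. -/
theorem card_maps_into (D : ℕ) (S : Finset (Fin n)) (T : Finset (Fin M)) :
    (Finset.univ.filter fun h : Fin n × Fin D → Fin M => ∀ i ∈ S, ∀ d, h (i, d) ∈ T).card =
      T.card ^ (D * S.card) * M ^ (D * (n - S.card)) := by
  have h1 : (Finset.univ.filter fun h : Fin n × Fin D → Fin M => ∀ i ∈ S, ∀ d, h (i, d) ∈ T) =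
      Fintype.piFinset fun p : Fin n × Fin D => if p.1 ∈ S then T else Finset.univ := by
    ext h
    simp only [Finset.mem_filter, Finset.mem_univ, true_and, Fintype.mem_piFinset, Prod.forall]
    refine forall_congr' fun i => ?_
    by_cases hi : i ∈ S <;> simp [hi]
  have hpow : ∀ g : Fin n → ℕ, ∏ p : Fin n × Fin D, g p.1 = ∏ i, g i ^ D := fun g => by
    simp [Fintype.prod_prod_type]
  rw [h1, Fintype.card_piFinset]
  refine (hpow fun i => (if i ∈ S then T else Finset.univ).card).trans ?_
  have h2 : ∀ i : Fin n, (if i ∈ S then T else Finset.univ).card ^ D =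
      if i ∈ S then T.card ^ D else M ^ D := fun i => by split_ifs <;> simp
  simp only [h2]
  rw [Finset.prod_ite, Finset.prod_const, Finset.prod_const, ← pow_mul, ← pow_mul]
  have h3 : (Finset.univ.filter fun i => i ∉ S).card = n - S.card := by
    have := Finset.card_filter_add_card_filter_not (s := (Finset.univ : Finset (Fin n))) (· ∈ S)
    simp only [Finset.filter_univ_mem, Finset.card_univ, Fintype.card_fin] at this
    omega
  rw [h3, Finset.filter_univ_mem]

/-- Random bipartite graphs of left degree `2 a + 3` expand small sets by the factor `a + 2`. -/
theorem exists_expander (hM : 1 ≤ M)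
    (h : 3 ^ (a + 4) * (a + 2) ^ (a + 1) * n * K ^ a ≤ M ^ (a + 1)) :
    ∃ f : Fin n × Fin (2 * a + 3) → Fin M, ∀ S : Finset (Fin n), S.card ≤ K →
      (a + 2) * S.card ≤ ((S ×ˢ Finset.univ).image f).card := by
  by_contra! hcon
  set D := 2 * a + 3 with hD
  let B : ℕ → Finset (Fin n × Fin D → Fin M) := fun w =>
    (Finset.powersetCard w Finset.univ).biUnion fun S =>
      (Finset.powersetCard ((a + 2) * w) Finset.univ).biUnion fun T =>
        Finset.univ.filter fun f => ∀ i ∈ S, ∀ d, f (i, d) ∈ T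
  have hB : ∀ w, 1 ≤ w → w ≤ K → w ≤ n → 3 ^ w * (B w).card ≤ M ^ (D * n) := by
    intro w hw hK hn
    have h1 : (B w).card ≤ n.choose w * (M.choose ((a + 2) * w) *
        (((a + 2) * w) ^ (D * w) * M ^ (D * (n - w)))) := by
      have h2 := Finset.card_biUnion_le_card_mul (Finset.powersetCard w Finset.univ)
        (fun S => (Finset.powersetCard ((a + 2) * w) Finset.univ).biUnion fun T =>
          Finset.univ.filter fun f : Fin n × Fin D → Fin M => ∀ i ∈ S, ∀ d, f (i, d) ∈ T)
        (M.choose ((a + 2) * w) * (((a + 2) * w) ^ (D * w) * M ^ (D * (n - w)))) (fun S hS => by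
          have h3 := Finset.card_biUnion_le_card_mul
            (Finset.powersetCard ((a + 2) * w) (Finset.univ : Finset (Fin M)))
            (fun T => Finset.univ.filter fun f : Fin n × Fin D → Fin M =>
              ∀ i ∈ S, ∀ d, f (i, d) ∈ T)
            (((a + 2) * w) ^ (D * w) * M ^ (D * (n - w))) (fun T hT => by
              rw [card_maps_into, (Finset.mem_powersetCard.1 hS).2,
                (Finset.mem_powersetCard.1 hT).2])
          simpa using h3)
      simpa using h2
    calc 3 ^ w * (B w).card ≤ 3 ^ w * (n.choose w * (M.choose ((a + 2) * w) *
        (((a + 2) * w) ^ (D * w) * M ^ (D * (n - w))))) := Nat.mul_le_mul_left _ h1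
      _ = 3 ^ w * (n.choose w * M.choose ((a + 2) * w) * ((a + 2) * w) ^ (D * w)) *
          M ^ (D * (n - w)) := by ring
      _ ≤ M ^ (D * w) * M ^ (D * (n - w)) := Nat.mul_le_mul_right _ (expander_term_le h hw hK)
      _ = _ := by rw [← pow_add, ← mul_add, Nat.add_sub_cancel' hn]
  have hcov : (Finset.univ : Finset (Fin n × Fin D → Fin M)) ⊆
      (Finset.Ico 1 (min K n + 1)).biUnion B := by
    intro f _
    obtain ⟨S, hS, hlt⟩ := hcon f
    have hSn : S.card ≤ n := by simpa using S.card_le_univ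
    have hS1 : 1 ≤ S.card := by
      by_contra h0
      have : S.card = 0 := by omega
      rw [this] at hlt
      omega
    obtain ⟨T, hT, hTc⟩ := Finset.exists_superset_card_eq hlt.le
      (by simpa using expander_size_le h hS hSn)
    refine Finset.mem_biUnion.2 ⟨S.card, ?_, ?_⟩
    · rw [Finset.mem_Ico]; omega
    · refine Finset.mem_biUnion.2 ⟨S, by simp, Finset.mem_biUnion.2 ⟨T, by simp [hTc], ?_⟩⟩
      rw [Finset.mem_filter]
      exact ⟨Finset.mem_univ _, fun i hi d =>
        hT (Finset.mem_image_of_mem f (Finset.mem_product.2 ⟨hi, Finset.mem_univ d⟩))⟩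
  have hcard := (Finset.card_le_card hcov).trans Finset.card_biUnion_le
  rw [Finset.card_univ, Fintype.card_fun, Fintype.card_prod, Fintype.card_fin, Fintype.card_fin,
    Fintype.card_fin, mul_comm n D] at hcard
  -- The geometric sum of `3 ^ (-w)` over `1 ≤ w ≤ N` is `(1 - 3 ^ (-N)) / 2 < 1`, so the bad maps
  -- cannot be all.
  have hsum : ∀ N : ℕ, N ≤ min K n →
      2 * 3 ^ N * ∑ w ∈ Finset.Ico 1 (N + 1), (B w).card ≤ (3 ^ N - 1) * M ^ (D * n) := by
    intro N
    induction N with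
    | zero => simp
    | succ N ih =>
      intro hN
      have ih := ih (by omega)
      have hb := hB (N + 1) (by omega) (by omega) (by omega)
      rw [Finset.sum_Ico_succ_top (by omega)]
      have h3 : 1 ≤ 3 ^ N := Nat.one_le_pow _ _ (by norm_num)
      obtain ⟨t, ht⟩ := Nat.exists_eq_add_of_le h3
      have h4 : 3 ^ (N + 1) - 1 = 3 * (3 ^ N - 1) + 2 := by rw [pow_succ]; omega
      rw [h4]
      calc _ = 3 * (2 * 3 ^ N * ∑ w ∈ Finset.Ico 1 (N + 1), (B w).card) +
            2 * (3 ^ (N + 1) * (B (N + 1)).card) := by ring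
        _ ≤ 3 * ((3 ^ N - 1) * M ^ (D * n)) + 2 * M ^ (D * n) := by gcongr
        _ = _ := by ring
  have h5 := hsum _ le_rfl
  have h6 : 0 < M ^ (D * n) := by positivity
  have h7 : 1 ≤ 3 ^ min K n := Nat.one_le_pow _ _ (by norm_num)
  have h8 := (Nat.mul_le_mul_left (2 * 3 ^ min K n) hcard).trans h5
  have h9 := Nat.le_of_mul_le_mul_right h8 h6
  omega

end Expander

/-! ### Condensers from unique neighbours. -/

section Condenser

variable {n M a K : ℕ}

/-- The vertices with a unique preimage under `f`. -/
theorem card_le_card_unique (f : Fin n × Fin (2 * a + 3) → Fin M) (S : Finset (Fin n))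
    (hS : (a + 2) * S.card ≤ ((S ×ˢ Finset.univ).image f).card) :
    S.card ≤ (Finset.univ.filter fun v =>
      ((S ×ˢ Finset.univ).filter fun p => f p = v).card = 1).card := by
  classical
  set E := S ×ˢ (Finset.univ : Finset (Fin (2 * a + 3))) with hE
  have h1 : E.card = ∑ v ∈ E.image f, (E.filter fun p => f p = v).card :=
    Finset.card_eq_sum_card_image f E
  -- A vertex that is not unique absorbs at least two of the `(2 a + 3) |S|` edges, which leaves at
  -- least `2 (a + 2) |S| - (2 a + 3) |S| = |S|` unique ones.
  have h2 : ∑ v ∈ E.image f, 2 ≤ ∑ v ∈ E.image f, ((E.filter fun p => f p = v).card +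
      if (E.filter fun p => f p = v).card = 1 then 1 else 0) := by
    refine Finset.sum_le_sum fun v hv => ?_
    obtain ⟨p, hp, rfl⟩ := Finset.mem_image.1 hv
    have : 0 < (E.filter fun p' => f p' = f p).card :=
      Finset.card_pos.2 ⟨p, Finset.mem_filter.2 ⟨hp, rfl⟩⟩
    split_ifs <;> omega
  rw [Finset.sum_add_distrib, ← h1, ← Finset.card_filter, Finset.sum_const, smul_eq_mul] at h2
  have h3 : ((E.image f).filter fun v => (E.filter fun p => f p = v).card = 1).card ≤
      (Finset.univ.filter fun v => (E.filter fun p => f p = v).card = 1).card :=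
    Finset.card_le_card (Finset.filter_subset_filter _ (Finset.subset_univ _))
  have h4 : E.card = S.card * (2 * a + 3) := by simp [hE]
  nlinarith

variable {F : Type*} [Field F] [DecidableEq F]

/-- A sparse linear map into fewer coordinates that does not decrease small weights. -/
theorem exists_condenser (hM : 1 ≤ M)
    (h : 3 ^ (a + 4) * (a + 2) ^ (a + 1) * n * K ^ a ≤ M ^ (a + 1)) :
    ∃ A : Matrix (Fin M) (Fin n) F,
      (∑ j, (Finset.univ.filter fun i => A j i ≠ 0).card ≤ n * (2 * a + 3)) ∧
      ∀ x : Fin n → F, hammingNorm x ≤ K → hammingNorm x ≤ hammingNorm (A.mulVecLin x) := by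
  classical
  obtain ⟨f, hf⟩ := exists_expander hM h
  refine ⟨fun v i => if ∃ d, f (i, d) = v then 1 else 0, ?_, fun x hx => ?_⟩
  · have h1 : ∀ v : Fin M, (Finset.univ.filter fun i : Fin n =>
        (if ∃ d, f (i, d) = v then (1 : F) else 0) ≠ 0).card ≤
        (Finset.univ.filter fun p => f p = v).card := by
      intro v
      refine le_trans (Finset.card_le_card ?_) (Finset.card_image_le (f := Prod.fst))
      intro i hi
      simp only [ne_eq, ite_eq_right_iff, one_ne_zero, imp_false, not_not, Finset.mem_filter,
        Finset.mem_univ, true_and] at hi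
      obtain ⟨d, hd⟩ := hi
      exact Finset.mem_image.2 ⟨(i, d), by simpa using hd, rfl⟩
    refine (Finset.sum_le_sum fun v _ => h1 v).trans (le_of_eq ?_)
    rw [← Finset.card_eq_sum_card_fiberwise fun _ _ => Finset.mem_coe.2 (Finset.mem_univ _)]
    simp
  · let S : Finset (Fin n) := Finset.univ.filter fun i => x i ≠ 0
    -- At a unique neighbour of the support only one nonzero coordinate arrives, so nothing cancels.
    refine (card_le_card_unique f S (hf S hx)).trans (Finset.card_le_card fun v hv => ?_)
    rw [Finset.mem_filter] at hv ⊢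
    refine ⟨Finset.mem_univ _, ?_⟩
    obtain ⟨⟨i, d⟩, hp⟩ := Finset.card_eq_one.1 hv.2
    have hmem : ∀ p, (p.1 ∈ S ∧ f p = v) ↔ p = (i, d) := fun p => by
      have := Finset.ext_iff.1 hp p
      simpa using this
    obtain ⟨hiS, hid⟩ := (hmem (i, d)).2 rfl
    have hval : ∑ i', (if ∃ d, f (i', d) = v then (1 : F) else 0) * x i' = x i := by
      rw [Finset.sum_eq_single i]
      · rw [if_pos ⟨d, hid⟩, one_mul]
      · intro i' _ hi'
        by_cases hx' : x i' = 0
        · rw [hx', mul_zero]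
        · rw [if_neg, zero_mul]
          rintro ⟨d', hd'⟩
          exact hi' (congrArg Prod.fst
            ((hmem (i', d')).1 ⟨Finset.mem_filter.2 ⟨Finset.mem_univ _, hx'⟩, hd'⟩))
      · intro hi
        exact absurd (Finset.mem_univ i) hi
    have hne : x i ≠ 0 := (Finset.mem_filter.1 hiS).2
    rw [← hval] at hne
    exact hne

end Condenser

/-! ### Base codes, and reduction to an inner code. -/

section

open LinearCircuit

theorem one_le_hammingNorm {F ι : Type*} [Field F] [DecidableEq F] [Fintype ι] {x : ι → F}
    (hx : x ≠ 0) : 1 ≤ hammingNorm x :=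
  hammingNorm_pos_iff.2 hx

theorem hammingNorm_le {F : Type*} [Field F] [DecidableEq F] {n : ℕ} (x : Fin n → F) :
    hammingNorm x ≤ n := by
  simpa using hammingNorm_le_card_fintype (x := x)

section BaseCode

variable {m a : ℕ}

/-- The condenser hypothesis at scale `i`. Tying the degree to the number of scales lets the `(a +
1)`-st power absorb `m ≤ 2 ^ a (K + 1)`. -/
theorem dyadic_condition {i : ℕ} (hi : i ≤ a) :
    3 ^ (a + 4) * (a + 2) ^ (a + 1) * m * (m / 2 ^ i) ^ a ≤
      (162 * (a + 2) * (m / 2 ^ i + 1)) ^ (a + 1) := by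
  set K := m / 2 ^ i with hK
  have h1 : m ≤ 2 ^ a * (K + 1) := by
    refine (Nat.lt_mul_div_succ m (by positivity : 0 < 2 ^ i)).le.trans ?_
    exact Nat.mul_le_mul_right _ (Nat.pow_le_pow_right (by norm_num) hi)
  calc _ ≤ 3 ^ (a + 4) * (a + 2) ^ (a + 1) * (2 ^ a * (K + 1)) * (K + 1) ^ a := by
        gcongr; omega
    _ = 81 * (3 * 2) ^ a * ((a + 2) ^ (a + 1) * (K + 1) ^ (a + 1)) := by rw [mul_pow]; ring
    _ ≤ 162 * 162 ^ a * ((a + 2) ^ (a + 1) * (K + 1) ^ (a + 1)) := by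
        gcongr <;> norm_num
    _ = _ := by rw [mul_pow, mul_pow]; ring

/-- The dyadic scale of a weight. -/
theorem exists_dyadic {w : ℕ} (hm : w ≤ m) (h : m ≤ 2 ^ (a + 1) * w) :
    ∃ i ≤ a, 2 ^ i * w ≤ m ∧ m ≤ 2 ^ (i + 1) * w := by
  classical
  have hex : ∃ i, m ≤ 2 ^ (i + 1) * w := ⟨a, h⟩
  refine ⟨Nat.find hex, Nat.find_min' hex h, ?_, Nat.find_spec hex⟩
  rcases hi : Nat.find hex with _ | i
  · simpa using hm
  · have := Nat.find_min hex (m := i) (by omega)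
    omega

variable {F : Type*} [Field F] [Fintype F] [DecidableEq F]

/-- Depth-2 codes for all weights at least `m / 2 ^ L`, with `O(m L ^ 2)` wires. -/
theorem exists_baseCode {m L : ℕ} (hm : 1 ≤ m) (hL : 1 ≤ L) :
    ∃ (G : (Fin m → F) →ₗ[F] (Fin (32 * m) → F)) (D : ℕ),
      Realizes G 2 (500000 * Fintype.card F * (m * L ^ 2)) D ∧
      ∀ x, x ≠ 0 → m ≤ 2 ^ L * hammingNorm x → 4 * m ≤ hammingNorm (G x) := by
  obtain ⟨a, rfl⟩ := Nat.exists_eq_add_of_le' hL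
  set q := Fintype.card F with hq
  have hq1 : 1 ≤ q := Fintype.card_pos
  let M : Fin (a + 1) → ℕ := fun i => 162 * (a + 2) * (m / 2 ^ (i : ℕ) + 1)
  have hM : ∀ i, 1 ≤ M i := fun i => Nat.succ_le_of_lt (by positivity)
  have hcond : ∀ i, ∃ A : Matrix (Fin (M i)) (Fin m) F,
      (∑ j, (Finset.univ.filter fun i => A j i ≠ 0).card ≤ m * (2 * a + 3)) ∧
      ∀ x : Fin m → F, hammingNorm x ≤ m / 2 ^ (i : ℕ) →
        hammingNorm x ≤ hammingNorm (A.mulVecLin x) := fun i =>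
    exists_condenser (hM i) (dyadic_condition (by omega))
  choose A hA hAx using hcond
  have : ∀ i, Nonempty (Fin (M i)) := fun i => ⟨⟨0, hM i⟩⟩
  -- At the scale of a weight `w`, `m / 2 ^ i + 1 ≤ 4 w`, so the block length is at most `4 * 162 (a
  -- + 2) w`.
  obtain ⟨B, hB, hBx⟩ := exists_amplifier (ρ := 648 * (a + 2)) hm (by omega)
    (sigmaMap fun i => (A i).mulVecLin)
    {x | x ≠ 0 ∧ m ≤ 2 ^ (a + 1) * hammingNorm x} (by
      rintro x ⟨hx, hmx⟩
      have hw := one_le_hammingNorm hx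
      obtain ⟨i, hi, h1, h2⟩ := exists_dyadic (hammingNorm_le x) hmx
      refine ⟨⟨i, by omega⟩, ?_⟩
      have h3 : hammingNorm x ≤ m / 2 ^ i := by
        rw [Nat.le_div_iff_mul_le (by positivity)]; linarith
      have h4 : m / 2 ^ i ≤ 2 * hammingNorm x := by
        refine Nat.div_le_of_le_mul (h2.trans (le_of_eq ?_))
        rw [pow_succ]; ring
      have h5 := hAx ⟨i, by omega⟩ x h3
      rw [Fintype.card_fin]
      change 162 * (a + 2) * (m / 2 ^ i + 1) ≤
        648 * (a + 2) * hammingNorm ((A ⟨i, by omega⟩).mulVecLin x)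
      calc 162 * (a + 2) * (m / 2 ^ i + 1) ≤ 162 * (a + 2) * (4 * hammingNorm x) := by
            gcongr; omega
        _ = 648 * (a + 2) * hammingNorm x := by ring
        _ ≤ _ := by gcongr)
  refine ⟨B.mulVecLin ∘ₗ sigmaMap fun i => (A i).mulVecLin, _, ((Realizes.sigma (D := m)
    (d := 1) (s := fun _ => m * (2 * a + 3)) fun i => realizes_mulVecLin (A i) _ _ (hA i)
      fun j => (Finset.card_le_univ _).trans (by simp)).comp
    (realizes_mulVecLin B (32 * m * (Fintype.card (Fin (a + 1)) * (10 * q * (648 * (a + 2)))))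
      _ ?_ hB)).mono le_rfl ?_ le_rfl, fun x hx hmx => hBx x ⟨hx, hmx⟩⟩
  · refine (Finset.sum_le_card_nsmul _ _ _ fun j _ => hB j).trans ?_
    simp [hq]
  · simp only [Finset.sum_const, Finset.card_univ, Fintype.card_fin, smul_eq_mul]
    have h1 : a + 2 ≤ 2 * (a + 1) := by omega
    calc (a + 1) * (m * (2 * a + 3)) + 32 * m * ((a + 1) * (10 * q * (648 * (a + 2))))
        ≤ (a + 1) * (m * (3 * (a + 1))) * q +
          32 * m * ((a + 1) * (10 * q * (648 * (2 * (a + 1))))) := by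
          refine Nat.add_le_add (le_trans ?_ (Nat.le_mul_of_pos_right _ hq1)) ?_
          · gcongr; omega
          · gcongr
      _ = 414723 * q * (m * (a + 1) ^ 2) := by ring
      _ ≤ _ := by gcongr; norm_num

end BaseCode

end

section

open LinearCircuit

variable {F : Type*} [Field F] [Fintype F] [DecidableEq F]

/-- A codeword of weight `4 m` out of `32 m` has density `1 / 8`, so amplification with `ρ = 8`
costs a fan-in independent of all lengths. -/
theorem exists_combiner {I : Type} [Fintype I] {n : ℕ} (hn : 1 ≤ n) (m : I → ℕ)
    (hm : ∀ i, 1 ≤ m i) (G : ∀ i, (Fin n → F) →ₗ[F] (Fin (32 * m i) → F))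
    (X : Set (Fin n → F)) (hX : ∀ x ∈ X, ∃ i, 4 * m i ≤ hammingNorm (G i x)) :
    ∃ A : Matrix (Fin (32 * n)) (Σ i, Fin (32 * m i)) F,
      (∀ j, (Finset.univ.filter fun i => A j i ≠ 0).card ≤
        Fintype.card I * (10 * Fintype.card F * 8)) ∧
      ∀ x ∈ X, 4 * n ≤ hammingNorm (A.mulVecLin (sigmaMap G x)) := by
  have : ∀ i, Nonempty (Fin (32 * m i)) := fun i => ⟨⟨0, by have := hm i; omega⟩⟩
  refine exists_amplifier hn (by norm_num) _ X fun x hx => ?_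
  obtain ⟨i, hi⟩ := hX x hx
  refine ⟨i, ?_⟩
  rw [Fintype.card_fin]
  change 32 * m i ≤ 8 * hammingNorm (G i x)
  omega

theorem log_add_one_sq_le (t : ℕ) (ht : 1 ≤ t) : (Nat.log 2 t + 1) ^ 2 ≤ 4 * t := by
  have h : ∀ j : ℕ, (j + 1) ^ 2 ≤ 4 * 2 ^ j := by
    intro j
    induction j with
    | zero => norm_num
    | succ j ih =>
      rcases Nat.lt_or_ge j 2 with h | h
      · interval_cases j <;> norm_num
      · rw [pow_succ 2 j]; nlinarith
  exact (h _).trans (Nat.mul_le_mul_left 4 (Nat.pow_log_le_self 2 (by omega)))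

/-- Weights between `n / (46656 r ^ 2) ^ 2` and `n / r`. -/
theorem exists_bridge {n r : ℕ} (hr : 1 ≤ r) (hrn : r ≤ n) :
    ∃ (m : ℕ) (G : (Fin n → F) →ₗ[F] (Fin (32 * m) → F)) (D : ℕ), 1 ≤ m ∧
      Realizes G 3 (4 * 10 ^ 11 * Fintype.card F * n) D ∧
      ∀ x, x ≠ 0 → n ≤ (46656 * r ^ 2) ^ 2 * hammingNorm x → r * hammingNorm x ≤ n →
        4 * m ≤ hammingNorm (G x) := by
  set q := Fintype.card F with hq
  have hq1 : 1 ≤ q := Fintype.card_pos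
  set t := Nat.sqrt r with ht
  have ht1 : 1 ≤ t := Nat.sqrt_pos.2 hr
  have htr : t * t ≤ r := Nat.sqrt_le r
  have htn : t ≤ n := (Nat.sqrt_le_self r).trans hrn
  set u := n / t with hu
  have hu1 : 1 ≤ u := Nat.div_pos htn ht1
  have hut : t * u ≤ n := Nat.mul_div_le n t
  have hun : n ≤ t * (u + 1) := (Nat.lt_mul_div_succ n ht1).le
  -- For `a = 1` the condenser constant is `3 ^ 5 * 3 ^ 2 = 2187 ≤ 47 ^ 2`.
  set M := 47 * (u + 1) with hM
  have hM1 : 1 ≤ M := by omega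
  have hcond : 3 ^ (1 + 4) * (1 + 2) ^ (1 + 1) * n * (n / r) ^ 1 ≤ M ^ (1 + 1) := by
    have h1 : n * (n / r) ≤ (u + 1) ^ 2 := by
      refine Nat.le_of_mul_le_mul_left (c := t * t) ?_ (by positivity)
      calc t * t * (n * (n / r)) ≤ r * (n * (n / r)) := by gcongr
        _ = n * (r * (n / r)) := by ring
        _ ≤ n * n := by gcongr; exact Nat.mul_div_le n r
        _ ≤ (t * (u + 1)) * (t * (u + 1)) := by gcongr
        _ = _ := by ring
    calc _ = 2187 * (n * (n / r)) := by ring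
      _ ≤ 2209 * (u + 1) ^ 2 := by gcongr; norm_num
      _ = _ := by rw [hM]; ring
  obtain ⟨A, hA, hAx⟩ := exists_condenser (F := F) hM1 hcond
  -- Chosen so that `94 * 46656 ^ 2 * r ^ 4 ≤ 2 ^ L`: `38` for the constant, `4` for rounding the
  -- logarithm.
  set L := 4 * Nat.log 2 r + 42 with hL
  obtain ⟨G, D, hG, hGx⟩ := exists_baseCode (F := F) (L := L) hM1 (by omega)
  refine ⟨M, G ∘ₗ A.mulVecLin, D, hM1, ((realizes_mulVecLin A _ n hA
    fun j => (Finset.card_le_univ _).trans (by simp)).comp hG).mono le_rfl ?_ le_rfl,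
    fun x hx h1 h2 => ?_⟩
  · have hlog : L ≤ 46 * (Nat.log 2 t + 1) := by
      have h1 : Nat.log 2 r < 2 * (Nat.log 2 t + 1) := by
        refine Nat.log_lt_of_lt_pow (by omega) ?_
        calc r < (t + 1) * (t + 1) := Nat.lt_succ_sqrt r
          _ ≤ 2 ^ (Nat.log 2 t + 1) * 2 ^ (Nat.log 2 t + 1) := by
            have := Nat.lt_pow_succ_log_self (b := 2) (by norm_num) t
            gcongr <;> exact this
          _ = _ := by rw [two_mul, ← pow_add]
      omega
    have hL2 : L ^ 2 ≤ 8464 * t := by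
      calc L ^ 2 ≤ (46 * (Nat.log 2 t + 1)) ^ 2 := by gcongr
        _ = 2116 * (Nat.log 2 t + 1) ^ 2 := by ring
        _ ≤ 2116 * (4 * t) := by gcongr; exact log_add_one_sq_le t ht1
        _ = _ := by ring
    have hML : M * L ^ 2 ≤ 795616 * n := by
      calc M * L ^ 2 ≤ (94 * u) * (8464 * t) := by gcongr; omega
        _ = 795616 * (t * u) := by ring
        _ ≤ _ := by gcongr
    calc n * (2 * 1 + 3) + 500000 * q * (M * L ^ 2)
        ≤ n * 5 * q + 500000 * q * (795616 * n) := by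
          refine Nat.add_le_add (Nat.le_mul_of_pos_right _ hq1) (by gcongr)
      _ = 397808000005 * q * n := by ring
      _ ≤ _ := by gcongr; norm_num
  · have hw := one_le_hammingNorm hx
    have h3 : hammingNorm x ≤ hammingNorm (A.mulVecLin x) :=
      hAx x ((Nat.le_div_iff_mul_le hr).2 (by linarith))
    refine hGx _ (hammingNorm_pos_iff.1 (hw.trans h3)) ?_
    have hr2 : r ≤ 2 ^ (Nat.log 2 r + 1) := (Nat.lt_pow_succ_log_self (by norm_num) r).le
    have hun' : u ≤ n := Nat.div_le_self n t
    calc M ≤ 94 * n := by omega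
      _ ≤ 94 * ((46656 * r ^ 2) ^ 2 * hammingNorm x) := by gcongr
      _ = 94 * 46656 ^ 2 * r ^ 4 * hammingNorm x := by ring
      _ ≤ 2 ^ 38 * (2 ^ (Nat.log 2 r + 1)) ^ 4 * hammingNorm x := by gcongr; norm_num
      _ = 2 ^ L * hammingNorm x := by rw [hL, ← pow_mul, ← pow_add]; ring_nf
      _ ≤ _ := by gcongr

/-- Weights at most `n / (46656 r ^ 2) ^ 2`, by a code on fewer coordinates. -/
theorem exists_condensed {F : Type*} [Field F] [DecidableEq F] {n s m a d σ D : ℕ} (hs : 46656 ≤ s) (hsn : s ^ 2 ≤ n) (hm : m = n / s + 1)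
    (G : (Fin m → F) →ₗ[F] (Fin (32 * m) → F)) (hG : Realizes G d σ D)
    (hGx : ∀ x, x ≠ 0 → m ≤ a * hammingNorm x → 4 * m ≤ hammingNorm (G x)) :
    ∃ G' : (Fin n → F) →ₗ[F] (Fin (32 * m) → F),
      Realizes G' (1 + d) (7 * n + σ) D ∧
      ∀ x, x ≠ 0 → n ≤ a * hammingNorm x → s ^ 2 * hammingNorm x ≤ n →
        4 * m ≤ hammingNorm (G' x) := by
  have hs0 : 0 < s := by omega
  have hnm : n ≤ s * m := hm ▸ (Nat.lt_mul_div_succ n hs0).le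
  -- The condenser with `a = 2`, of degree `7`; its constant `3 ^ 6 * 4 ^ 3 = 46656` is absorbed by
  -- `s`.
  have hcond : 3 ^ (2 + 4) * (2 + 2) ^ (2 + 1) * n * (n / s ^ 2) ^ 2 ≤ m ^ (2 + 1) := by
    refine Nat.le_of_mul_le_mul_left (c := s ^ 4) ?_ (by positivity)
    calc s ^ 4 * (3 ^ (2 + 4) * (2 + 2) ^ (2 + 1) * n * (n / s ^ 2) ^ 2)
        = 46656 * n * (s ^ 2 * (n / s ^ 2)) ^ 2 := by ring
      _ ≤ s * n * n ^ 2 := by gcongr; exact Nat.mul_div_le n _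
      _ = s * n ^ 3 := by ring
      _ ≤ s * (s * m) ^ 3 := by gcongr
      _ = _ := by ring
  obtain ⟨A, hA, hAx⟩ := exists_condenser (F := F) (hm ▸ Nat.succ_pos _) hcond
  refine ⟨G ∘ₗ A.mulVecLin, ((realizes_mulVecLin A _ n hA
    fun j => (Finset.card_le_univ _).trans (by simp)).comp hG).mono le_rfl (by omega) le_rfl,
    fun x hx h1 h2 => ?_⟩
  have h3 : hammingNorm x ≤ hammingNorm (A.mulVecLin x) :=
    hAx x ((Nat.le_div_iff_mul_le (by positivity)).2 (by linarith))
  refine hGx _ (hammingNorm_pos_iff.1 ((one_le_hammingNorm hx).trans h3)) ?_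
  have hmn : m ≤ n := by
    have h4 : n / s ≤ n / 2 := Nat.div_le_div_left (by omega) (by norm_num)
    have h5 : 46656 ^ 2 ≤ n := (Nat.pow_le_pow_left hs 2).trans hsn
    omega
  exact hmn.trans (h1.trans (Nat.mul_le_mul_left a h3))

/-- A code on fewer coordinates gives a code for all weights from `n / a` to `n / r`, whose outputs
have bounded fan-in. -/
theorem exists_code_of_inner {n r a d σ : ℕ} (hr : 1 ≤ r) (hrn : r ≤ n) (hd : 2 ≤ d)
    (H : (46656 * r ^ 2) ^ 2 ≤ n →
      ∃ (G : (Fin (n / (46656 * r ^ 2) + 1) → F) →ₗ[F]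
          (Fin (32 * (n / (46656 * r ^ 2) + 1)) → F)) (D : ℕ),
        Realizes G d σ D ∧ ∀ x, x ≠ 0 → n / (46656 * r ^ 2) + 1 ≤ a * hammingNorm x →
          4 * (n / (46656 * r ^ 2) + 1) ≤ hammingNorm (G x)) :
    ∃ G : (Fin n → F) →ₗ[F] (Fin (32 * n) → F),
      Realizes G (d + 2) (σ + 5 * 10 ^ 11 * Fintype.card F * n) (160 * Fintype.card F) ∧
      ∀ x, x ≠ 0 → n ≤ a * hammingNorm x → r * hammingNorm x ≤ n → 4 * n ≤ hammingNorm (G x) := by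
  set q := Fintype.card F with hq
  have hq1 : 1 ≤ q := Fintype.card_pos
  set s := 46656 * r ^ 2 with hs
  have hs1 : 46656 ≤ s := Nat.le_mul_of_pos_right _ (by positivity)
  have hn : 1 ≤ n := hr.trans hrn
  obtain ⟨m₂, G₂, D₂, hm₂, hG₂, hx₂⟩ := exists_bridge (F := F) hr hrn
  obtain ⟨G₁, D, hG₁, hx₁⟩ : ∃ (G₁ : (Fin n → F) →ₗ[F] (Fin (32 * (n / s + 1)) → F)) (D : ℕ),
      Realizes G₁ (1 + d) (7 * n + σ) D ∧
      ∀ x, x ≠ 0 → n ≤ a * hammingNorm x → s ^ 2 * hammingNorm x ≤ n →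
        4 * (n / s + 1) ≤ hammingNorm (G₁ x) := by
    by_cases hsn : s ^ 2 ≤ n
    · obtain ⟨G, D, hG, hGx⟩ := H hsn
      obtain ⟨G', h⟩ := exists_condensed hs1 hsn rfl G hG hGx
      exact ⟨G', D, h⟩
    -- No nonzero vector has weight at most `n / s ^ 2 < 1`, so the zero map will do.
    · refine ⟨(0 : Matrix _ _ F).mulVecLin, 0, (realizes_mulVecLin 0 0 0 (by simp) (by simp)).mono
        (by omega) (by omega) (by omega), fun x hx _ h => absurd ?_ hsn⟩
      exact (Nat.le_mul_of_pos_right _ (one_le_hammingNorm hx)).trans h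
  let m : Bool → ℕ := fun b => bif b then n / s + 1 else m₂
  let G : ∀ b, (Fin n → F) →ₗ[F] (Fin (32 * m b) → F) := fun b =>
    match b with
    | true => G₁
    | false => G₂
  let σ' : Bool → ℕ := fun b => bif b then 7 * n + σ else 4 * 10 ^ 11 * q * n
  have hG : ∀ b, Realizes (G b) (1 + d) (σ' b) (max D D₂) := by
    rintro (_ | _)
    · exact hG₂.mono (by omega) le_rfl (le_max_right _ _)
    · exact hG₁.mono le_rfl le_rfl (le_max_left _ _)
  obtain ⟨A, hA, hAx⟩ := exists_combiner hn m (by rintro (_ | _); exacts [hm₂, Nat.succ_pos _]) G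
    {x | x ≠ 0 ∧ n ≤ a * hammingNorm x ∧ r * hammingNorm x ≤ n} (by
      rintro x ⟨hx, h1, h2⟩
      rcases Nat.le_total (s ^ 2 * hammingNorm x) n with h | h
      · exact ⟨true, hx₁ x hx h1 h⟩
      · exact ⟨false, hx₂ x hx h h2⟩)
  refine ⟨A.mulVecLin ∘ₗ sigmaMap G, ((Realizes.sigma hG).comp (realizes_mulVecLin A
    (32 * n * (Fintype.card Bool * (10 * q * 8))) _ ?_ hA)).mono (by omega) ?_ ?_,
    fun x hx h1 h2 => hAx x ⟨hx, h1, h2⟩⟩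
  · refine (Finset.sum_le_card_nsmul _ _ _ fun j _ => hA j).trans ?_
    simp [hq]
  · simp only [Fintype.sum_bool, σ', cond_true, cond_false, Fintype.card_bool]
    have : n ≤ q * n := Nat.le_mul_of_pos_left _ hq1
    nlinarith
  · rw [Fintype.card_bool]; omega

end

/-! ### The Ackermann hierarchy and its inverse. -/

theorem ackA_one (i : ℕ) : ackA i 1 = 2 := by
  cases i <;> simp [ackA]

theorem ackA_succ_succ (i j : ℕ) : ackA (i + 1) (j + 2) = ackA i (ackA (i + 1) (j + 1)) := by
  rw [ackA]

theorem ackA_gt (i j : ℕ) : j + 2 ≤ ackA i (j + 1) := by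
  induction i generalizing j with
  | zero => simp only [ackA]; omega
  | succ i ih =>
    induction j with
    | zero => rw [ackA_one]
    | succ j ihj =>
      rw [ackA_succ_succ]
      obtain ⟨t, ht⟩ := Nat.exists_eq_add_of_le' (show 1 ≤ ackA (i + 1) (j + 1) by omega)
      rw [ht]
      exact le_trans (by omega) (ih t)

theorem ackA_two_pow (j : ℕ) : ackA 1 (j + 1) = 2 ^ (j + 1) := by
  induction j with
  | zero => rw [ackA_one]; rfl
  | succ j ih =>
    rw [ackA_succ_succ, ih, ackA]
    ring

/-- `iterStar f` counts the iterations until the value is at most `1`. -/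
theorem iterStar_le_iff {f : ℕ → ℕ} (hf : ∀ r ≤ 1, f r ≤ 1) {r : ℕ} (hr : ∃ i, f^[i] r ≤ 1)
    (j : ℕ) : iterStar f r ≤ j ↔ f^[j] r ≤ 1 := by
  constructor
  · intro h
    -- `hr` excludes the default value `0` of `sInf` on the empty set; `hf` keeps later iterates at
    -- most `1`.
    have h1 : f^[iterStar f r] r ≤ 1 := Nat.sInf_mem (s := {i | f^[i] r ≤ 1}) hr
    obtain ⟨t, rfl⟩ := Nat.exists_eq_add_of_le h
    clear h
    induction t with
    | zero => exact h1
    | succ t ih =>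
      rw [← add_assoc, Function.iterate_succ_apply']
      exact hf _ ih
  · exact fun h => Nat.sInf_le (s := {i | f^[i] r ≤ 1}) h

/-- As `f` is adjoint to `ackA (k + 1)`, each application of `f` peels off one step of the recursion
for `ackA (k + 2)`. -/
theorem iterate_le_one_iff {f : ℕ → ℕ} {k : ℕ}
    (hf : ∀ r j, f r ≤ j + 1 ↔ r ≤ ackA (k + 1) (j + 1)) (r j : ℕ) :
    f^[j + 1] r ≤ 1 ↔ r ≤ ackA (k + 2) (j + 1) := by
  induction j generalizing r with
  | zero =>
    rw [ackA_one, zero_add, Function.iterate_one]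
    have := hf r 0
    rwa [zero_add, ackA_one] at this
  | succ j ih =>
    rw [Function.iterate_succ_apply, ih, ackA_succ_succ]
    obtain ⟨t, ht⟩ := Nat.exists_eq_add_of_le'
      (show 1 ≤ ackA (k + 2) (j + 1) from le_trans (by omega) (ackA_gt (k + 2) j))
    rw [ht]
    exact hf r t

theorem iterStar_le_iff_iterate {f : ℕ → ℕ} {k : ℕ}
    (hf : ∀ r j, f r ≤ j + 1 ↔ r ≤ ackA (k + 1) (j + 1)) (r j : ℕ) :
    iterStar f r ≤ j ↔ f^[j] r ≤ 1 := by
  refine iterStar_le_iff (fun r hr => ?_) ?_ j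
  · exact (hf r 0).2 (hr.trans (le_trans (by omega) (ackA_gt _ 0)))
  · exact ⟨r + 1, (iterate_le_one_iff hf r r).2 (le_trans (by omega) (ackA_gt _ r))⟩

/-- `lam (2 k)` is the inverse of `ackA k`. -/
theorem lam_le_iff (k r j : ℕ) : lam (2 * (k + 1)) r ≤ j + 1 ↔ r ≤ ackA (k + 1) (j + 1) := by
  induction k generalizing r j with
  | zero =>
    rw [ackA_two_pow]
    exact Nat.clog_le_iff_le_pow (by norm_num)
  | succ k ih => exact (iterStar_le_iff_iterate ih r _).trans (iterate_le_one_iff ih r j)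

theorem lam_pos (k : ℕ) {r : ℕ} (hr : 2 ≤ r) : 1 ≤ lam (2 * (k + 1)) r := by
  rcases k with _ | k
  · exact Nat.clog_pos (by norm_num) hr
  · by_contra! h
    have : r ≤ 1 := (iterStar_le_iff_iterate (lam_le_iff k) r 0).1 (Nat.lt_one_iff.1 h).le
    omega

/-! ### The recursion over depth. -/

section

open LinearCircuit

variable {F : Type*} [Field F] [Fintype F] [DecidableEq F]

/-- The consecutive ranges between the values of `ackA` cover all weights. -/
theorem exists_ackA_range {k t n w : ℕ} (hw : w ≤ n) (h : n ≤ ackA (k + 1) (t + 1) * w) :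
    ∃ i ≤ t, n ≤ ackA k (if i = 0 then 1 else ackA (k + 1) i) * w ∧
      (if i = 0 then 1 else ackA (k + 1) i) * w ≤ n := by
  classical
  have hex : ∃ i, n ≤ ackA (k + 1) (i + 1) * w := ⟨t, h⟩
  refine ⟨Nat.find hex, Nat.find_min' hex h, ?_⟩
  have hspec := Nat.find_spec hex
  rcases hi : Nat.find hex with _ | i
  · rw [hi] at hspec
    simp only [if_true, ackA_one, zero_add] at hspec ⊢
    exact ⟨hspec, by omega⟩
  · rw [hi, ackA_succ_succ] at hspec
    have := Nat.find_min hex (m := i) (by omega)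
    simp only [Nat.add_eq_zero_iff, one_ne_zero, and_false, if_false]
    exact ⟨hspec, by omega⟩

/-- Codes for all weights at least `n / r`, merged from codes for consecutive ranges. -/
theorem exists_code_of_ranges {k c D : ℕ} (hc : 2560 * Fintype.card F * D ≤ c)
    (H : ∀ n r : ℕ, 1 ≤ r → r ≤ n → ∃ G : (Fin n → F) →ₗ[F] (Fin (32 * n) → F),
      Realizes G (2 * (k + 1)) (2 * c * n) D ∧
      ∀ x, x ≠ 0 → n ≤ ackA k r * hammingNorm x → r * hammingNorm x ≤ n →
        4 * n ≤ hammingNorm (G x))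
    (n r : ℕ) (hr : 2 ≤ r) (hrn : r ≤ n) :
    ∃ (G : (Fin n → F) →ₗ[F] (Fin (32 * n) → F)) (D' : ℕ),
      Realizes G (2 * (k + 1)) (3 * c * lam (2 * (k + 1)) r * n) D' ∧
      ∀ x, x ≠ 0 → n ≤ r * hammingNorm x → 4 * n ≤ hammingNorm (G x) := by
  have hinv := lam_le_iff k r
  obtain ⟨t, ht⟩ := Nat.exists_eq_add_of_le' (lam_pos k hr)
  rw [ht] at hinv ⊢
  have hrt : r ≤ ackA (k + 1) (t + 1) := (hinv t).1 le_rfl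
  -- Each endpoint is `ackA k` of the previous one. The first is set to `1`, since `ackA (k + 1) 0`
  -- is a junk value and `ackA k 1 = 2 = ackA (k + 1) 1`.
  let ρ : Fin (t + 1) → ℕ := fun i => if (i : ℕ) = 0 then 1 else ackA (k + 1) i
  have hρ : ∀ i, 1 ≤ ρ i ∧ ρ i ≤ n := by
    rintro ⟨i, hi⟩
    rcases i with _ | i
    · simp only [ρ, if_true]; omega
    · have h1 := ackA_gt (k + 1) i
      have h2 := mt (hinv i).2 (by omega)
      simp only [ρ, Nat.add_eq_zero_iff, one_ne_zero, and_false, if_false]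
      omega
  choose G hG hGx using fun i => H n (ρ i) (hρ i).1 (hρ i).2
  obtain ⟨A, hA, hAx⟩ := exists_combiner (by omega) (fun _ : Fin (t + 1) => n) (by omega) G
    {x | x ≠ 0 ∧ n ≤ r * hammingNorm x} (by
      rintro x ⟨hx, h⟩
      obtain ⟨i, hi, h1, h2⟩ := exists_ackA_range (k := k) (t := t) (hammingNorm_le x)
        (h.trans (Nat.mul_le_mul_right _ hrt))
      exact ⟨⟨i, by omega⟩, hGx ⟨i, by omega⟩ x hx h1 h2⟩)
  -- Merging keeps the depth; it costs `2560 q D ≤ c` wires per range and coordinate, which turns `2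
  -- c` into `3 c`.
  refine ⟨A.mulVecLin ∘ₗ sigmaMap G, _, ((Realizes.sigma hG).merge (by omega) A hA).mono le_rfl ?_
    le_rfl, fun x hx h => hAx x ⟨hx, h⟩⟩
  simp only [Finset.sum_const, Finset.card_univ, Fintype.card_fin, smul_eq_mul]
  calc (t + 1) * (2 * c * n) + 32 * n * ((t + 1) * (10 * Fintype.card F * 8) * D)
      = (t + 1) * (2 * c * n) + (2560 * Fintype.card F * D) * (t + 1) * n := by ring
    _ ≤ (t + 1) * (2 * c * n) + c * (t + 1) * n := by gcongr
    _ = _ := by ring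

/-- The constant of the size bounds. -/
def sizeConst (F : Type*) [Fintype F] : ℕ := 10 ^ 12 * Fintype.card F ^ 2

theorem condensed_size_le {n r : ℕ} (h : (46656 * r ^ 2) ^ 2 ≤ n) :
    46656 * r ^ 2 * (n / (46656 * r ^ 2) + 1) ≤ 2 * n := by
  set s := 46656 * r ^ 2
  have h1 : s * (n / s) ≤ n := Nat.mul_div_le n s
  have h2 : s ≤ s ^ 2 := Nat.le_self_pow (by norm_num) s
  rw [mul_add]; omega

theorem le_sizeConst (F : Type*) [Field F] [Fintype F] : 5 * 10 ^ 11 * Fintype.card F ≤ sizeConst F := by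
  have hq1 : 1 ≤ Fintype.card F := Fintype.card_pos
  rw [sizeConst, pow_two, ← mul_assoc]
  nlinarith

/-- Codes on fewer coordinates of size at most `sizeConst F * n` give linear-size codes. -/
theorem exists_linearSizeCode {n r a d : ℕ} (hr : 1 ≤ r) (hrn : r ≤ n) (hd : 2 ≤ d)
    (H : ∀ m, (46656 * r ^ 2) ^ 2 ≤ n → 2 ≤ m → 46656 * r ^ 2 * m ≤ 2 * n →
      ∃ (G : (Fin m → F) →ₗ[F] (Fin (32 * m) → F)) (D : ℕ),
        Realizes G d (sizeConst F * n) D ∧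
        ∀ x, x ≠ 0 → m ≤ a * hammingNorm x → 4 * m ≤ hammingNorm (G x)) :
    ∃ G : (Fin n → F) →ₗ[F] (Fin (32 * n) → F),
      Realizes G (d + 2) (2 * sizeConst F * n) (160 * Fintype.card F) ∧
      ∀ x, x ≠ 0 → n ≤ a * hammingNorm x → r * hammingNorm x ≤ n → 4 * n ≤ hammingNorm (G x) := by
  obtain ⟨G, hG, hGx⟩ := exists_code_of_inner (F := F) (a := a) hr hrn hd
    (fun h => H _ h (Nat.succ_le_succ (Nat.div_pos
      ((Nat.le_self_pow (by norm_num) _).trans h) (by positivity))) (condensed_size_le h))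
  refine ⟨G, hG.mono le_rfl ?_ le_rfl, hGx⟩
  calc _ ≤ sizeConst F * n + sizeConst F * n := by gcongr; exact le_sizeConst F
    _ = _ := by ring

/-- Linear-size codes for the weights between `n / ackA (k + 1) r` and `n / r`. -/
theorem exists_rangeCode (k : ℕ) : ∀ n r : ℕ, 1 ≤ r → r ≤ n →
    ∃ G : (Fin n → F) →ₗ[F] (Fin (32 * n) → F),
      Realizes G (2 * (k + 2)) (2 * sizeConst F * n) (160 * Fintype.card F) ∧
      ∀ x, x ≠ 0 → n ≤ ackA (k + 1) r * hammingNorm x → r * hammingNorm x ≤ n →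
        4 * n ≤ hammingNorm (G x) := by
  have hq1 : 1 ≤ Fintype.card F := Fintype.card_pos
  induction k with
  | zero =>
    intro n r hr hrn
    refine exists_linearSizeCode (d := 2) hr hrn le_rfl fun m _ hm hmn => ?_
    -- Since `ackA 1 r = 2 ^ r`, `L = r` works; the `m r ^ 2` wires are `O(n)` on the condensed
    -- length.
    obtain ⟨G, D, hG, hGx⟩ := exists_baseCode (F := F) (m := m) (by omega) hr
    refine ⟨G, D, hG.mono le_rfl ?_ le_rfl, fun x hx h => hGx x hx ?_⟩
    · calc 500000 * Fintype.card F * (m * r ^ 2)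
          ≤ 500000 * Fintype.card F * (46656 * r ^ 2 * m) := by gcongr 500000 * _ * ?_; nlinarith
        _ ≤ 500000 * Fintype.card F * (2 * n) := by gcongr
        _ = 10 ^ 6 * Fintype.card F * n := by ring
        _ ≤ 5 * 10 ^ 11 * Fintype.card F * n := by gcongr; norm_num
        _ ≤ _ := by gcongr; exact le_sizeConst F
    · obtain ⟨t, rfl⟩ := Nat.exists_eq_add_of_le' hr
      rwa [← ackA_two_pow]
  | succ k ih =>
    intro n r hr hrn
    refine exists_linearSizeCode (d := 2 * (k + 2)) hr hrn (by omega) fun m _ hm hmn => ?_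
    obtain ⟨t, rfl⟩ := Nat.exists_eq_add_of_le' hr
    have h2 : 2 ≤ ackA (k + 2) (t + 1) := le_trans (by omega) (ackA_gt _ t)
    -- The threshold is capped at `m`, which loses nothing because nonzero vectors have weight at
    -- least one. At most `t + 1` ranges occur, so the size is at most `3 c (t + 1) m ≤ c n`.
    obtain ⟨G, D, hG, hGx⟩ := exists_code_of_ranges (k := k + 1) (c := sizeConst F)
      (by rw [sizeConst]; nlinarith) ih m (min (ackA (k + 2) (t + 1)) m) (le_min h2 hm)
      (min_le_right _ _)
    refine ⟨G, D, hG.mono le_rfl ?_ le_rfl, fun x hx h => hGx x hx ?_⟩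
    · have h3 := (lam_le_iff (k + 1) _ t).2 (min_le_left (ackA (k + 2) (t + 1)) m)
      calc _ ≤ 3 * sizeConst F * (t + 1) * m := by gcongr
        _ = sizeConst F * (3 * (t + 1) * m) := by ring
        _ ≤ sizeConst F * n := by gcongr; nlinarith
    · rcases le_total (ackA (k + 2) (t + 1)) m with h' | h'
      · rwa [min_eq_left h']
      · rw [min_eq_right h']
        exact Nat.le_mul_of_pos_right _ (one_le_hammingNorm hx)

theorem isPartialGoodCode_of_nat {F : Type*} [Field F] [DecidableEq F] {n a r : ℕ} (ha : 1 ≤ a) (hr : 1 ≤ r)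
    {L : (Fin n → F) →ₗ[F] (Fin (32 * n) → F)}
    (h : ∀ x, x ≠ 0 → n ≤ a * hammingNorm x → r * hammingNorm x ≤ n → 4 * n ≤ hammingNorm (L x)) :
    IsPartialGoodCode n ((n : ℝ) / (a : ℝ)) ((n : ℝ) / (r : ℝ)) L := by
  intro x hx h1 h2
  rw [div_le_iff₀' (by exact_mod_cast ha)] at h1
  rw [le_div_iff₀' (by exact_mod_cast hr)] at h2
  exact h x hx (by exact_mod_cast h1) (by exact_mod_cast h2)

end

theorem mainTheorem3 (F : Type*) [Field F] [Fintype F] [DecidableEq F] (c₀ : ℝ) (hc₀ : 0 < c₀) :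
    ∃ (c : ℝ) (D : ℕ), 0 < c ∧ 0 < D ∧
      (∀ n r k : ℕ, c₀ ≤ (r : ℝ) → r ≤ n → 3 ≤ k →
        ∃ (L : (Fin n → F) →ₗ[F] (Fin (32 * n) → F))
          (C : LinearCircuit F (Fin n) (Fin (32 * n))),
          IsPartialGoodCode n ((n : ℝ) / (ackA (k - 1) r : ℝ)) ((n : ℝ) / (r : ℝ)) L ∧
          C.Computes L ∧ C.depth ≤ ((2 * k : ℕ) : ℕ∞) ∧
          (C.size : ℝ) ≤ 2 * c * (n : ℝ) ∧
          ∀ j : Fin (32 * n), C.fanIn (C.output j) ≤ D) ∧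
      (∀ n r k : ℕ, 2 ≤ r → r ≤ n → 2 ≤ k →
        ∃ (L : (Fin n → F) →ₗ[F] (Fin (32 * n) → F))
          (C : LinearCircuit F (Fin n) (Fin (32 * n))),
          IsPartialGoodCode n ((n : ℝ) / (r : ℝ)) (n : ℝ) L ∧
          C.Computes L ∧ C.depth ≤ ((2 * k : ℕ) : ℕ∞) ∧
          (C.size : ℝ) ≤ 3 * c * (lam (2 * k) r : ℝ) * (n : ℝ)) := by
  have hq1 : 1 ≤ Fintype.card F := Fintype.card_pos
  refine ⟨sizeConst F, 160 * Fintype.card F, ?_, by omega, fun n r k hr hrn hk => ?_,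
    fun n r k hr hrn hk => ?_⟩
  · rw [sizeConst]
    exact_mod_cast (by positivity : 0 < 10 ^ 12 * Fintype.card F ^ 2)
  -- A positive integer is at least one, so the constants need not depend on `c₀`.
  · have hr1 : 1 ≤ r := by exact_mod_cast hc₀.trans_le hr
    obtain ⟨k, rfl⟩ := Nat.exists_eq_add_of_le' (show 2 ≤ k by omega)
    obtain ⟨t, rfl⟩ := Nat.exists_eq_add_of_le' hr1
    obtain ⟨G, hG, hGx⟩ := exists_rangeCode (F := F) k n (t + 1) hr1 hrn
    obtain ⟨C, hC, hd, hs, hD⟩ := hG.exists_circuit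
    exact ⟨G, C, isPartialGoodCode_of_nat (le_trans (by omega) (ackA_gt (k + 1) t)) hr1 hGx, hC, hd,
      by exact_mod_cast hs, hD⟩
  · obtain ⟨k, rfl⟩ := Nat.exists_eq_add_of_le' hk
    obtain ⟨G, D, hG, hGx⟩ := exists_code_of_ranges (k := k + 1) (c := sizeConst F)
      (by rw [sizeConst]; nlinarith) (exists_rangeCode k) n r hr hrn
    obtain ⟨C, hC, hd, hs, -⟩ := hG.exists_circuit
    refine ⟨G, C, ?_, hC, hd, by exact_mod_cast hs⟩
    have := isPartialGoodCode_of_nat (a := r) (r := 1) (L := G) (by omega) le_rfl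
      fun x hx h _ => hGx x hx h
    simpa using this
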